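/- Let $G$ be a finite simple planar graph, i.e. a finite simple graph that can be drawn in the plane with distinct points as vertices and simple arcs as edges, each arc joining the two ends of its edge and containing no other vertex, so that two distinct arcs meet at most in common ends. Let $g\ge 3$ be an integer, and suppose that $G$ has girth at least $g$, i.e. every cycle of $G$ has length at least $g$ (a forest has infinite girth). Then $$\mathrm{mad}(G)<\frac{2g}{g-2},$$ where $\mathrm{mad}(G)=\max_{H\subseteq G,\ |V(H)|\ge 1}\frac{2|E(H)|}{|V(H)|}$ is the maximum average degree of $G$ (taken to be $0$ if $G$ has no vertices). -/

import Mathlib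

/-- The Euclidean plane. -/
abbrev Plane : Type := EuclideanSpace ℝ (Fin 2)

/-- `A` is a (simple, continuous) arc in the plane joining `p` to `q`: the image of an injective
path from `p` to `q`. -/
def IsArcBetween (p q : Plane) (A : Set Plane) : Prop :=
  ∃ γ : Path p q, Function.Injective γ ∧ Set.range γ = A

/-- A drawing of a simple graph in the plane without crossings: distinct vertices are distinct
points, every edge is an arc joining its two ends, an edge contains no vertices other than its
two ends, and any two distinct edges meet only in vertices. -/
structure PlaneDrawing {V : Type*} (G : SimpleGraph V) where
  /-- the position of a vertex -/
  point : V → Plane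
  /-- the arc that represents an edge (only the values on edges of `G` matter) -/
  arc : Sym2 V → Set Plane
  point_injective : Function.Injective point
  isArcBetween : ∀ u v : V, G.Adj u v → IsArcBetween (point u) (point v) (arc s(u, v))
  mem_of_point_mem : ∀ e ∈ G.edgeSet, ∀ w : V, point w ∈ arc e → w ∈ e
  inter_subset : ∀ e ∈ G.edgeSet, ∀ f ∈ G.edgeSet, e ≠ f → arc e ∩ arc f ⊆ Set.range point

/-- A graph is planar if it can be drawn in the plane without crossings. -/
def IsPlanar {V : Type*} (G : SimpleGraph V) : Prop := Nonempty (PlaneDrawing G)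

/-- The average degrees `2|E(H)| / |V(H)|` of the subgraphs `H` of `G` with at least one vertex. -/
def subgraphAverageDegrees {V : Type*} (G : SimpleGraph V) : Set ℝ :=
  {x | ∃ H : G.Subgraph, 1 ≤ H.verts.ncard ∧
    x = 2 * (H.edgeSet.ncard : ℝ) / (H.verts.ncard : ℝ)}

/-- The maximum average degree of a finite graph. For a finite graph with at least one vertex the
supremum is a maximum, see `mad_isGreatest`; the graph without vertices gets the value `0`. -/
noncomputable def mad {V : Type*} (G : SimpleGraph V) : ℝ := sSup (subgraphAverageDegrees G)

theorem mad_isGreatest {V : Type*} [Finite V] [Nonempty V] (G : SimpleGraph V) :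
    IsGreatest (subgraphAverageDegrees G) (mad G) := by
  have hfin : (subgraphAverageDegrees G).Finite := by
    refine (Set.finite_range (fun H : G.Subgraph =>
      2 * (H.edgeSet.ncard : ℝ) / (H.verts.ncard : ℝ))).subset ?_
    rintro x ⟨H, -, rfl⟩
    exact ⟨H, rfl⟩
  have hne : (subgraphAverageDegrees G).Nonempty := by
    refine ⟨_, ⊤, ?_, rfl⟩
    rw [SimpleGraph.Subgraph.verts_top, Set.ncard_univ]
    exact Nat.card_pos
  exact ⟨hne.csSup_mem hfin, fun x hx => le_csSup hfin.bddAbove hx⟩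

/-! A planar graph with `n ≥ 1` vertices, `m` edges and girth at least `g` satisfies `g (m + 1) ≤ 2
m + g n` (`IsPlanar.mul_ncard_edgeSet_le`). For a densest subgraph this gives `(g - 2) m ≤ g (n - 1)
< g n`, which is the claim.

The bound is a face count in which faces are replaced by functionals on the mod 2 cycle space: a
point off the drawing sends a cycle to its winding parity around the point. Crossing an edge `e`
changes this functional by `C ↦ C e`. The edges with a given functional `φ` on exactly one side form
a cycle `b φ`, and every cycle `C` is the sum of the `φ C • b φ`. So the nonzero `b φ` span the
cycle space, whose dimension is at least `m - n + 1`; each has at least `g` edges, and an edge lies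
in at most two of them (`SimpleGraph.mul_card_edgeSet_le_of_sides`).

Winding parity comes from square roots. Off the curve of an edge with ends `p`, `q`, the function
`(p - x) * (q - x)` has a continuous square root. The product of these roots over a cycle has the
same square as a polynomial, so their quotient is a sign, locally constant off the cycle; it flips
across each edge of the cycle (`SidedDrawing`). To obtain such roots, the arcs are made straight
near the vertices (`StarDrawing`) and their middle parts are replaced by connected unions of
segments inside disjoint neighbourhoods (`StarDrawing.exists_mid_sqrt`). -/

/-! ### Cycle space, girth and the abstract face count -/

open scoped Classical in
/-- The mod 2 boundary map of a finite graph. Its kernel is the cycle space. -/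
noncomputable def SimpleGraph.boundary {V : Type*} [Fintype V] (G : SimpleGraph V) :
    (G.edgeSet → ZMod 2) →ₗ[ZMod 2] (V → ZMod 2) where
  toFun C v := ∑ e : G.edgeSet, if v ∈ e.1 then C e else 0
  map_add' C D := by
    ext v
    simp only [Pi.add_apply, ← Finset.sum_add_distrib]
    exact Finset.sum_congr rfl fun e _ => by split_ifs <;> simp
  map_smul' a C := by
    ext v
    simp [Finset.mul_sum]

open scoped Classical in
theorem SimpleGraph.mem_ker_boundary {V : Type*} [Fintype V] {G : SimpleGraph V}
    {C : G.edgeSet → ZMod 2} :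
    C ∈ LinearMap.ker G.boundary ↔ ∀ v, ∑ e : G.edgeSet, (if v ∈ e.1 then C e else 0) = 0 := by
  rw [LinearMap.mem_ker, funext_iff]
  rfl

open scoped Classical in
theorem SimpleGraph.filter_mem_edge {V : Type*} [Fintype V] (u v : V) :
    (Finset.univ.filter fun w => w ∈ s(u, v)) = {u, v} := by
  ext w
  simp

-- Every edge has two ends, so boundaries lie in the hyperplane of functions with sum zero and the
-- boundary map has rank at most `n - 1`.
open scoped Classical in
theorem SimpleGraph.card_add_one_le_finrank_ker_boundary {V : Type*} [Fintype V] [Nonempty V]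
    (G : SimpleGraph V) :
    Fintype.card G.edgeSet + 1 ≤
      Fintype.card V + Module.finrank (ZMod 2) (LinearMap.ker G.boundary) := by
  let S : (V → ZMod 2) →ₗ[ZMod 2] ZMod 2 := ∑ v, LinearMap.proj v
  have hS : ∀ f, S f = ∑ v, f v := fun f => by simp [S]
  have hsurj : Function.Surjective S := fun a =>
    ⟨Pi.single (Classical.arbitrary V) a, by rw [hS]; simp⟩
  have hle : LinearMap.range G.boundary ≤ LinearMap.ker S := by
    rintro _ ⟨C, rfl⟩
    rw [LinearMap.mem_ker, hS]
    change ∑ v, ∑ e : G.edgeSet, (if v ∈ e.1 then C e else 0) = 0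
    rw [Finset.sum_comm]
    refine Finset.sum_eq_zero fun e _ => ?_
    obtain ⟨e, he⟩ := e
    induction e using Sym2.ind with
    | _ u v =>
    have huv : u ≠ v := G.ne_of_adj he
    rw [← Finset.sum_filter, SimpleGraph.filter_mem_edge, Finset.sum_pair huv]
    exact CharTwo.add_self_eq_zero _
  have h1 := LinearMap.finrank_range_add_finrank_ker G.boundary
  have h2 := LinearMap.finrank_range_add_finrank_ker S
  have h3 := Submodule.finrank_mono hle
  rw [LinearMap.range_eq_top.2 hsurj, finrank_top] at h2
  simp only [Module.finrank_fintype_fun_eq_card, Module.finrank_self] at h1 h2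
  omega

open scoped Classical in
/-- A nonempty finite graph with all degrees different from one has a cycle. -/
theorem SimpleGraph.not_isAcyclic_of_degree_ne_one {V : Type*} [Fintype V] {H : SimpleGraph V}
    (hdeg : ∀ u v, H.Adj u v → ∃ w, H.Adj u w ∧ w ≠ v) {a b : V} (hab : H.Adj a b) :
    ¬ H.IsAcyclic := by
  intro hac
  -- Take a longest path. Its first vertex has a neighbour other than the second vertex: on the path
  -- it would close a cycle, off the path it would extend the path.
  let Q : ℕ → Prop := fun n => ∃ (u v : V) (p : H.Walk u v), p.IsPath ∧ p.length = n
  have hQ1 : Q 1 := ⟨a, b, hab.toWalk, by simp [SimpleGraph.Adj.toWalk, hab.ne], rfl⟩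
  have hbd : ∀ n, Q n → n ≤ Fintype.card V := by
    rintro n ⟨u, v, p, hp, rfl⟩
    exact hp.length_lt.le
  have hmax := Nat.findGreatest_spec (P := Q) (hbd 1 hQ1) hQ1
  have hge := Nat.le_findGreatest (P := Q) (hbd 1 hQ1) hQ1
  have hall : ∀ n, Q n → n ≤ Nat.findGreatest Q (Fintype.card V) :=
    fun n hn => Nat.le_findGreatest (hbd n hn) hn
  generalize Nat.findGreatest Q (Fintype.card V) = N at hmax hge hall
  obtain ⟨u, v, p, hp, hlen⟩ := hmax
  cases p with
  | nil => simp at hlen; omega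
  | cons h q =>
    rename_i x
    obtain ⟨w, hw, hne⟩ := hdeg u x h
    by_cases hmem : w ∈ (SimpleGraph.Walk.cons h q).support
    · exact hne (by simpa using hac.eq_snd_of_adj_start hp hw hmem)
    · have := hall _ ⟨w, v, .cons hw.symm (.cons h q), hp.cons hmem, rfl⟩
      simp at this hlen
      omega

-- The support of `C`, as a graph, has no vertex of degree one, since the boundary there would be a
-- single nonzero value. So it contains a cycle, which is a cycle of `G`.
open scoped Classical in
theorem SimpleGraph.le_card_support_of_mem_ker_boundary {V : Type*} [Fintype V]
    {G : SimpleGraph V} {g : ℕ} (hg : (g : ℕ∞) ≤ G.egirth) {C : G.edgeSet → ZMod 2}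
    (hC : C ∈ LinearMap.ker G.boundary) (hC0 : C ≠ 0) :
    g ≤ (Finset.univ.filter fun e => C e ≠ 0).card := by
  rw [SimpleGraph.mem_ker_boundary] at hC
  let s : Set (Sym2 V) := {e | ∃ h : e ∈ G.edgeSet, C ⟨e, h⟩ ≠ 0}
  let H := SimpleGraph.fromEdgeSet s
  have hadj : ∀ u v, H.Adj u v ↔ ∃ h : G.Adj u v, C ⟨s(u, v), h⟩ ≠ 0 := by
    intro u v
    simp only [H, SimpleGraph.fromEdgeSet_adj, s, Set.mem_ofPred_eq]
    exact ⟨fun h => h.1, fun h => ⟨h, G.ne_of_adj h.1⟩⟩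
  have hHG : H ≤ G := fun u v h => ((hadj u v).1 h).1
  obtain ⟨e, he⟩ := Function.ne_iff.1 hC0
  obtain ⟨a, b, hab⟩ : ∃ a b, H.Adj a b := by
    obtain ⟨e, h⟩ := e
    induction e using Sym2.ind with
    | _ u v => exact ⟨u, v, (hadj u v).2 ⟨h, he⟩⟩
  have hcyc : ¬ H.IsAcyclic := by
    refine SimpleGraph.not_isAcyclic_of_degree_ne_one (fun u v huv => ?_) hab
    by_contra! hcon
    obtain ⟨h, h1⟩ := (hadj u v).1 huv
    have h2 := hC u
    rw [Finset.sum_eq_single ⟨s(u, v), h⟩] at h2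
    · rw [if_pos (by simp)] at h2
      exact h1 h2
    · rintro ⟨f, hf⟩ - hne
      split_ifs with hm
      · obtain ⟨w, rfl⟩ := Sym2.mem_iff_exists.1 hm
        by_contra h3
        exact hne (Subtype.ext (congrArg (fun y => s(u, y)) (hcon w ((hadj u w).2 ⟨hf, h3⟩))))
      · rfl
    · simp
  obtain ⟨c, w, hw⟩ : ∃ c, ∃ w : H.Walk c c, w.IsCycle := by
    simpa [SimpleGraph.IsAcyclic] using hcyc
  have h1 : (g : ℕ∞) ≤ w.length := by
    have := hg.trans (SimpleGraph.egirth_le_length (hw.mapLe hHG))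
    simpa using this
  have h2 : w.edges.toFinset ⊆
      (Finset.univ.filter fun e => C e ≠ 0).image (Subtype.val : G.edgeSet → Sym2 V) := by
    intro f hf
    have hf' := w.edges_subset_edgeSet (List.mem_toFinset.1 hf)
    induction f using Sym2.ind with
    | _ u v =>
    obtain ⟨h, h3⟩ := (hadj u v).1 hf'
    exact Finset.mem_image.2 ⟨⟨s(u, v), h⟩, by simpa using h3, rfl⟩
  calc g ≤ w.length := by exact_mod_cast h1
    _ = w.edges.toFinset.card := by
      rw [List.toFinset_card_of_nodup hw.edges_nodup, SimpleGraph.Walk.length_edges]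
    _ ≤ _ := (Finset.card_le_card h2).trans Finset.card_image_le

open scoped Classical in
/-- A system of functionals on the cycle space that behaves like the sides of the edges of a
graph drawn in the plane bounds the number of edges in terms of the girth. -/
theorem SimpleGraph.mul_card_edgeSet_le_of_sides {V : Type*} [Fintype V] [Nonempty V]
    {G : SimpleGraph V} {g : ℕ} (hg : (g : ℕ∞) ≤ G.egirth)
    (L R : V → G.edgeSet → Module.Dual (ZMod 2) (LinearMap.ker G.boundary))
    (hLR : ∀ (v : V) (e : G.edgeSet), v ∈ e.1 → ∀ C, L v e C + R v e C = C.1 e)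
    (hLL : ∀ (u v : V) (e : G.edgeSet), u ∈ e.1 → v ∈ e.1 → ∀ C, C.1 e = 0 → L u e C = L v e C)
    (hrot : ∀ v : V, ∃ σ : Equiv.Perm {e : G.edgeSet // v ∈ e.1}, ∀ e, R v (σ e) = L v e) :
    g * (Fintype.card G.edgeSet + 1) ≤ 2 * Fintype.card G.edgeSet + g * Fintype.card V := by
  let D := Module.Dual (ZMod 2) (LinearMap.ker G.boundary)
  have : Finite D := Module.finite_of_finite (ZMod 2)
  have : Fintype D := Fintype.ofFinite D
  -- If both sides of `e` are `φ`, the ones cancel: `B v φ` marks the edges with `φ` on exactly one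
  -- side.
  let B : V → D → G.edgeSet → ZMod 2 :=
    fun v φ e => (if L v e = φ then 1 else 0) + (if R v e = φ then 1 else 0)
  -- the two sides of an edge do not depend on the end from which they are seen
  have hB : ∀ (u v : V) (e : G.edgeSet), u ∈ e.1 → v ∈ e.1 → ∀ φ, B u φ e = B v φ e := by
    intro u v e hu hv φ
    -- The two left sides agree on the cycles that avoid `e`, so they differ by `0` or by `C ↦ C e`.
    -- In the second case the left side at `u` is the right side at `v`.
    have hcase : L u e = L v e ∨ L u e = R v e := by
      by_cases h : ∃ C₀, L u e C₀ ≠ L v e C₀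
      · right
        obtain ⟨C₀, h0⟩ := h
        have z2 : ∀ a b : ZMod 2, a ≠ b → a = b + 1 := by decide
        have z1 : ∀ a : ZMod 2, a ≠ 0 → a = 1 := by decide
        have hC₀ : C₀.1 e = 1 := z1 _ fun h1 => h0 (hLL u v e hu hv C₀ h1)
        have key : ∀ C, L u e C = L v e C + C.1 e := by
          intro C
          by_cases h1 : C.1 e = 0
          · rw [h1, add_zero, hLL u v e hu hv C h1]
          · have h2 := hLL u v e hu hv (C - C₀) (by simp [hC₀, z1 _ h1])
            rw [map_sub, map_sub, sub_eq_sub_iff_add_eq_add, z2 _ _ h0] at h2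
            rw [z1 _ h1]
            linear_combination h2
        ext C
        rw [key, ← hLR v e hv]
        linear_combination CharTwo.add_self_eq_zero (L v e C)
      · left
        push Not at h
        exact LinearMap.ext h
    have hsum : L u e + R u e = L v e + R v e := by
      ext C
      simp [hLR u e hu, hLR v e hv]
    rcases hcase with h | h
    · have h' : R u e = R v e := by rw [h] at hsum; exact add_left_cancel hsum
      simp only [B, h, h']
    · have h' : R u e = L v e := by
        rw [h, add_comm (L v e)] at hsum; exact add_left_cancel hsum
      simp only [B, h, h', add_comm]
  have hend : ∀ e : G.edgeSet, ∃ v, v ∈ e.1 := fun e => ⟨_, e.1.out_fst_mem⟩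
  choose x hx using hend
  let b : D → G.edgeSet → ZMod 2 := fun φ e => B (x e) φ e
  -- Around `v` the left sides are a permutation of the right sides, so each `φ` occurs there an
  -- even number of times.
  have hbker : ∀ φ, b φ ∈ LinearMap.ker G.boundary := by
    intro φ
    rw [SimpleGraph.mem_ker_boundary]
    intro v
    obtain ⟨σ, hσ⟩ := hrot v
    have h1 : ∑ e : G.edgeSet, (if v ∈ e.1 then b φ e else 0) =
        ∑ e : {e : G.edgeSet // v ∈ e.1}, B v φ e := by
      rw [← Finset.sum_filter]
      rw [Finset.sum_subtype (p := fun e : G.edgeSet => v ∈ e.1) _ (by simp)]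
      exact Finset.sum_congr rfl fun e _ => hB _ _ _ (hx _) e.2 φ
    rw [h1]
    simp only [B]
    rw [Finset.sum_add_distrib, ← Equiv.sum_comp σ fun e : {e : G.edgeSet // v ∈ e.1} =>
      if R v e = φ then (1 : ZMod 2) else 0]
    simp only [hσ]
    exact CharTwo.add_self_eq_zero _
  -- At `e` only the two sides of `e` contribute, and they give `L C + R C = C e`.
  have hspan : ∀ C : LinearMap.ker G.boundary, C.1 = ∑ φ : D, φ C • b φ := by
    intro C
    ext e
    have hsel : ∀ ψ : D, ∑ φ : D, (if ψ = φ then φ C else 0) = ψ C := by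
      intro ψ
      rw [Finset.sum_eq_single ψ (fun φ _ h => if_neg (Ne.symm h)) (by simp), if_pos rfl]
    simp only [Finset.sum_apply, Pi.smul_apply, b, B, smul_eq_mul, mul_add, mul_ite, mul_one,
      mul_zero, Finset.sum_add_distrib]
    rw [hsel, hsel]
    exact (hLR _ _ (hx e) C).symm
  let N : Finset D := Finset.univ.filter fun φ => b φ ≠ 0
  have hdim : Module.finrank (ZMod 2) (LinearMap.ker G.boundary) ≤ N.card := by
    have hle : LinearMap.ker G.boundary ≤ Submodule.span (ZMod 2) (N.image b : Set _) := by
      intro C hC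
      have hC' := hspan ⟨C, hC⟩
      rw [show C = _ from hC']
      refine Submodule.sum_mem _ fun φ _ => ?_
      by_cases h : b φ = 0
      · simp [h]
      · refine Submodule.smul_mem _ _ (Submodule.subset_span ?_)
        exact Finset.mem_coe.2 (Finset.mem_image_of_mem _ (by simp [N, h]))
    exact (Submodule.finrank_mono hle).trans
      ((finrank_span_finset_le_card _).trans Finset.card_image_le)
  have hcount : g * N.card ≤ 2 * Fintype.card G.edgeSet := by
    have h1 : g * N.card ≤ ∑ φ ∈ N, (Finset.univ.filter fun e => b φ e ≠ 0).card := by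
      rw [mul_comm, ← smul_eq_mul]
      refine Finset.card_nsmul_le_sum _ _ _ fun φ hφ => ?_
      exact SimpleGraph.le_card_support_of_mem_ker_boundary hg (hbker φ) (by simpa [N] using hφ)
    have h2 : ∑ φ ∈ N, (Finset.univ.filter fun e => b φ e ≠ 0).card =
        ∑ e : G.edgeSet, (N.filter fun φ => b φ e ≠ 0).card :=
      Finset.sum_card_bipartiteAbove_eq_sum_card_bipartiteBelow fun φ e => b φ e ≠ 0
    have h3 : ∀ e ∈ (Finset.univ : Finset G.edgeSet), (N.filter fun φ => b φ e ≠ 0).card ≤ 2 := by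
      intro e _
      refine le_trans (Finset.card_le_card (t := {L (x e) e, R (x e) e}) ?_) Finset.card_le_two
      intro φ hφ
      by_contra h
      simp only [Finset.mem_insert, Finset.mem_singleton, not_or] at h
      refine (Finset.mem_filter.1 hφ).2 ?_
      simp only [b, B, if_neg (Ne.symm h.1), if_neg (Ne.symm h.2), add_zero]
    have h4 := Finset.sum_le_card_nsmul _ _ _ h3
    rw [Finset.card_univ, smul_eq_mul] at h4
    omega
  have h := G.card_add_one_le_finrank_ker_boundary
  calc g * (Fintype.card G.edgeSet + 1) ≤ g * (Fintype.card V + N.card) := 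
        Nat.mul_le_mul_left _ (by omega)
    _ ≤ _ := by rw [mul_add]; omega

/-! ### Cyclic order of the edges at a vertex -/

/-- The angles of finitely many rays from a point have a cyclic successor permutation. -/
theorem Real.Angle.exists_cyclic_successor {D : Type*} [Finite D] (a : D → ℝ)
    (ha : Function.Injective fun d => (a d : Real.Angle)) :
    ∃ (σ : Equiv.Perm D) (δ : D → ℝ), (∀ d, 0 < δ d) ∧
      (∀ d, (a (σ d) : Real.Angle) = ((a d + δ d : ℝ) : Real.Angle)) ∧
      ∀ d d' t, 0 < t → t < δ d → ((a d + t : ℝ) : Real.Angle) ≠ a d' := by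
  -- Gaps lie in `(0, 2π]`, so the gap from a ray to itself is a full turn and a lone ray is its own
  -- successor.
  let gap : D → D → ℝ := fun d d' => toIocMod Real.two_pi_pos 0 (a d' - a d)
  have hgap : ∀ d d', 0 < gap d d' ∧ gap d d' ≤ 2 * Real.pi := fun d d' => by
    have := toIocMod_mem_Ioc Real.two_pi_pos 0 (a d' - a d)
    rw [zero_add] at this
    exact this
  have hmin : ∀ d, ∃ d', ∀ d'', gap d d' ≤ gap d d'' := fun d =>
    have : Nonempty D := ⟨d⟩
    Finite.exists_min (gap d)
  choose s hs using hmin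
  have hadd : ∀ d, (a (s d) : Real.Angle) = ((a d + gap d (s d) : ℝ) : Real.Angle) := by
    intro d
    have h := toIocMod_add_toIocDiv_zsmul Real.two_pi_pos 0 (a (s d) - a d)
    rw [Real.Angle.angle_eq_iff_two_pi_dvd_sub]
    refine ⟨toIocDiv Real.two_pi_pos 0 (a (s d) - a d), ?_⟩
    simp only [zsmul_eq_mul] at h
    simp only [gap]
    linarith
  have hempty : ∀ d d' t, 0 < t → t < gap d (s d) → ((a d + t : ℝ) : Real.Angle) ≠ a d' := by
    intro d d' t h0 h1 h
    rw [Real.Angle.angle_eq_iff_two_pi_dvd_sub] at h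
    obtain ⟨k, hk⟩ := h
    have h2 : gap d d' = t := by
      refine (toIocMod_eq_iff Real.two_pi_pos).2 ⟨⟨h0, ?_⟩, -k, ?_⟩
      · rw [zero_add]
        exact h1.le.trans (hgap _ _).2
      · simp only [zsmul_eq_mul, Int.cast_neg]
        linarith
    exact absurd (hs d d') (by rw [h2]; exact not_le.2 h1)
  -- With a common successor and unequal gaps, the ray with the shorter gap would lie strictly
  -- inside the gap of the other.
  have hlt : ∀ d d', s d = s d' → ¬ gap d (s d) < gap d' (s d') := by
    intro d d' h hlt
    refine hempty d' d (gap d' (s d') - gap d (s d)) (sub_pos.2 hlt)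
      (by linarith [(hgap d (s d)).1]) ?_
    have h1 := hadd d
    rw [h, hadd d'] at h1
    rw [← h] at h1 ⊢
    rw [add_sub, Real.Angle.coe_sub, h1, Real.Angle.coe_add, add_sub_cancel_right]
  have hinj : Function.Injective s := by
    intro d d' h
    have h1 := le_antisymm (not_lt.1 (hlt d' d h.symm)) (not_lt.1 (hlt d d' h))
    have h2 := hadd d
    rw [h1, h, hadd d', Real.Angle.coe_add, Real.Angle.coe_add] at h2
    exact ha (add_right_cancel h2).symm
  exact ⟨Equiv.ofBijective s (Finite.injective_iff_bijective.1 hinj), fun d => gap d (s d),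
    fun d => (hgap _ _).1, hadd, hempty⟩

/-! ### Continuous square roots off segments and connected sets -/

/-- A square root of `(p - w) * (q - w)` that is continuous in `w` off the segment `[p, q]`. -/
noncomputable def segSqrt (p q w : ℂ) : ℂ := (p - w) * ((q - w) / (p - w)) ^ (2⁻¹ : ℂ)

theorem cpow_half_sq (z : ℂ) : (z ^ (2⁻¹ : ℂ)) ^ 2 = z := by
  exact_mod_cast Complex.cpow_nat_inv_pow z two_ne_zero

theorem segSqrt_sq {p q w : ℂ} (h : w ≠ p) : segSqrt p q w ^ 2 = (p - w) * (q - w) := by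
  have : p - w ≠ 0 := sub_ne_zero.2 h.symm
  rw [segSqrt, mul_pow, cpow_half_sq]
  field_simp

/-- If the quotient is `-t` with `t ≥ 0`, then `w = (t p + q) / (1 + t)` lies on the segment. Hence
the branch cut of the root is met only there. -/
theorem div_mem_slitPlane_of_notMem_segment {p q w : ℂ} (h : w ∉ segment ℝ p q) :
    (q - w) / (p - w) ∈ Complex.slitPlane := by
  by_contra hs
  have hp : p - w ≠ 0 := by
    intro h0
    exact h (by rw [← sub_eq_zero.1 h0]; exact left_mem_segment ℝ p q)
  rw [Complex.mem_slitPlane_iff_not_le_zero, not_not, Complex.le_def] at hs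
  obtain ⟨hre, him⟩ := hs
  set t := -((q - w) / (p - w)).re with ht
  have ht0 : 0 ≤ t := by simpa [ht] using hre
  have hz : (q - w) / (p - w) = -(t : ℂ) := by
    apply Complex.ext
    · simp [ht]
    · simpa using him
  rw [div_eq_iff hp] at hz
  apply h
  refine ⟨t / (1 + t), 1 / (1 + t), by positivity, by positivity, by field_simp; ring, ?_⟩
  have h1 : (1 + t : ℂ) ≠ 0 := by
    have : (1 + t) ≠ 0 := by positivity
    exact_mod_cast this
  simp only [Complex.real_smul, Complex.ofReal_div, Complex.ofReal_add, Complex.ofReal_one]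
  field_simp
  linear_combination hz

theorem continuousOn_segSqrt (p q : ℂ) : ContinuousOn (segSqrt p q) (segment ℝ p q)ᶜ := by
  intro w hw
  have hp : p - w ≠ 0 := by
    intro h0
    exact hw (by rw [← sub_eq_zero.1 h0]; exact left_mem_segment ℝ p q)
  have hs := div_mem_slitPlane_of_notMem_segment hw
  refine ContinuousAt.continuousWithinAt ?_
  unfold segSqrt
  exact (continuousAt_const.sub continuousAt_id).mul
    (((continuousAt_const.sub continuousAt_id).div (continuousAt_const.sub continuousAt_id) hp).cpow
      continuousAt_const hs)

open Filter Topology in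
/-- The square root changes its sign across the segment. -/
theorem tendsto_segSqrt_div_segSqrt (v : ℂ) {r : ℝ} (hr : 0 < r) (α : ℝ) :
    Tendsto (fun η : ℝ =>
      segSqrt v (v + (2 * r : ℝ) * Complex.exp (α * Complex.I))
          (v + r * Complex.exp ((α + η : ℝ) * Complex.I)) /
        segSqrt v (v + (2 * r : ℝ) * Complex.exp (α * Complex.I))
          (v + r * Complex.exp ((α - η : ℝ) * Complex.I)))
      (𝓝[>] 0) (𝓝 (-1)) := by
  have hr' : (r : ℂ) ≠ 0 := by exact_mod_cast hr.ne'
  -- The circle of radius `r` crosses the segment of length `2r` at its midpoint. On it the quotient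
  -- under the root is `1 - 2 exp (-η i)`, with imaginary part `2 sin η`; it tends to `-1` from
  -- above or below the cut according to the sign of `η`, and the root to `i` or `-i`.
  have key : ∀ η : ℝ, segSqrt v (v + (2 * r : ℝ) * Complex.exp (α * Complex.I))
      (v + r * Complex.exp ((α + η : ℝ) * Complex.I)) =
      -(r * Complex.exp ((α + η : ℝ) * Complex.I)) *
        (1 - 2 * Complex.exp (-η * Complex.I)) ^ (2⁻¹ : ℂ) := by
    intro η
    have he : Complex.exp (α * Complex.I) =
        Complex.exp ((α + η : ℝ) * Complex.I) * Complex.exp (-η * Complex.I) := by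
      rw [← Complex.exp_add]
      congr 1
      push_cast
      ring
    have h0 := Complex.exp_ne_zero ((α + η : ℝ) * Complex.I)
    rw [segSqrt, he]
    congr 1
    · ring
    · congr 1
      rw [div_eq_iff]
      · push_cast
        ring
      · rw [sub_add_cancel_left]
        exact neg_ne_zero.2 (mul_ne_zero hr' h0)
  have hre : ∀ η : ℝ, (1 - 2 * Complex.exp (-η * Complex.I)).im = 2 * Real.sin η := by
    intro η
    rw [← Complex.ofReal_neg, Complex.exp_mul_I, ← Complex.ofReal_cos, ← Complex.ofReal_sin]
    simp [Complex.sin_ofReal_re]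
  have hc : Continuous fun η : ℝ => 1 - 2 * Complex.exp (-η * Complex.I) := by fun_prop
  have hlim : Tendsto (fun η : ℝ => 1 - 2 * Complex.exp (-η * Complex.I)) (𝓝 0) (𝓝 (-1)) := by
    have h := hc.tendsto 0
    norm_num at h
    simpa only [neg_mul] using h
  have hsin : ∀ᶠ η in 𝓝[>] (0 : ℝ), 0 < Real.sin η := by
    filter_upwards [Ioo_mem_nhdsGT Real.pi_pos] with η hη
    exact Real.sin_pos_of_pos_of_lt_pi hη.1 hη.2
  have hpos : Tendsto (fun η : ℝ => (1 - 2 * Complex.exp (-η * Complex.I)) ^ (2⁻¹ : ℂ))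
      (𝓝[>] 0) (𝓝 Complex.I) := by
    have h1 : Tendsto (fun η : ℝ => 1 - 2 * Complex.exp (-η * Complex.I)) (𝓝[>] 0)
        (𝓝[{z : ℂ | 0 ≤ z.im}] (-1)) := by
      refine tendsto_nhdsWithin_iff.2 ⟨hlim.mono_left nhdsWithin_le_nhds, ?_⟩
      filter_upwards [hsin] with η hη
      rw [hre]
      positivity
    have h2 := (Complex.tendsto_log_nhdsWithin_im_nonneg_of_re_neg_of_im_zero
      (z := -1) (by simp) (by simp)).comp h1
    have h3 := (Complex.continuous_exp.tendsto _).comp (h2.mul_const (2⁻¹ : ℂ))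
    have h4 : Complex.exp ((Real.log ‖(-1 : ℂ)‖ + Real.pi * Complex.I) * 2⁻¹) = Complex.I := by
      rw [← Complex.exp_pi_div_two_mul_I]
      congr 1
      simp
      ring
    rw [h4] at h3
    refine h3.congr' ?_
    filter_upwards [hsin] with η hη
    have hne : 1 - 2 * Complex.exp (-η * Complex.I) ≠ 0 := by
      intro h
      have := hre η
      rw [h] at this
      simp at this
      linarith
    rw [Complex.cpow_def_of_ne_zero hne]
    rfl
  have hneg : Tendsto (fun η : ℝ => (1 - 2 * Complex.exp (-(-η : ℝ) * Complex.I)) ^ (2⁻¹ : ℂ))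
      (𝓝[>] 0) (𝓝 (-Complex.I)) := by
    have h0 : Tendsto (fun η : ℝ => -η) (𝓝[>] 0) (𝓝 0) := by
      have := (continuous_neg (G := ℝ)).tendsto 0
      rw [neg_zero] at this
      exact this.mono_left nhdsWithin_le_nhds
    have h1 : Tendsto (fun η : ℝ => 1 - 2 * Complex.exp (-(-η : ℝ) * Complex.I)) (𝓝[>] 0)
        (𝓝[{z : ℂ | z.im < 0}] (-1)) := by
      refine tendsto_nhdsWithin_iff.2 ⟨hlim.comp h0, ?_⟩
      filter_upwards [hsin] with η hη
      rw [hre, Real.sin_neg]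
      linarith
    have h2 := (Complex.tendsto_log_nhdsWithin_im_neg_of_re_neg_of_im_zero
      (z := -1) (by simp) (by simp)).comp h1
    have h3 := (Complex.continuous_exp.tendsto _).comp (h2.mul_const (2⁻¹ : ℂ))
    have h4 : Complex.exp ((Real.log ‖(-1 : ℂ)‖ - Real.pi * Complex.I) * 2⁻¹) = -Complex.I := by
      rw [← Complex.exp_neg_pi_div_two_mul_I]
      congr 1
      simp
      ring
    rw [h4] at h3
    refine h3.congr' ?_
    filter_upwards [hsin] with η hη
    have hne : 1 - 2 * Complex.exp (-(-η : ℝ) * Complex.I) ≠ 0 := by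
      intro h
      have := hre (-η)
      rw [h, Real.sin_neg] at this
      simp at this
      linarith
    rw [Complex.cpow_def_of_ne_zero hne]
    rfl
  have hexp : ∀ s : ℝ, Tendsto (fun η : ℝ => -(r * Complex.exp ((α + s * η : ℝ) * Complex.I)))
      (𝓝[>] 0) (𝓝 (-(r * Complex.exp (α * Complex.I)))) := by
    intro s
    have hc : Continuous fun η : ℝ => -(r * Complex.exp ((α + s * η : ℝ) * Complex.I)) := by
      fun_prop
    have := hc.tendsto 0
    rw [mul_zero, add_zero] at this
    exact this.mono_left nhdsWithin_le_nhds
  have hne : -(r * Complex.exp (α * Complex.I)) ≠ 0 :=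
    neg_ne_zero.2 (mul_ne_zero hr' (Complex.exp_ne_zero _))
  have h := ((hexp 1).mul hpos).div ((hexp (-1)).mul hneg)
    (mul_ne_zero hne (neg_ne_zero.2 Complex.I_ne_zero))
  have hval : -(r * Complex.exp (α * Complex.I)) * Complex.I /
      (-(r * Complex.exp (α * Complex.I)) * -Complex.I) = -1 := by
    rw [mul_div_mul_left _ _ hne, div_neg, div_self Complex.I_ne_zero]
  rw [hval] at h
  refine h.congr fun η => ?_
  have h1 := key η
  have h2 := key (-η)
  rw [← sub_eq_add_neg] at h2
  rw [h1, h2]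
  simp only [one_mul, neg_one_mul, Pi.div_apply, ← sub_eq_add_neg]

/-- Two points of a connected subset of an open set are joined inside the open set by a closed
connected set off which `(p - x) * (q - x)` has a continuous square root. -/
theorem exists_continuous_sqrt {U S : Set ℂ} (hU : IsOpen U) (hS : IsPreconnected S) (hSU : S ⊆ U)
    {p q : ℂ} (hp : p ∈ S) (hq : q ∈ S) :
    ∃ K ⊆ U, IsClosed K ∧ IsPreconnected K ∧ p ∈ K ∧ q ∈ K ∧
      ∃ h : ℂ → ℂ, ContinuousOn h Kᶜ ∧ ∀ x ∉ K, h x ^ 2 = (p - x) * (q - x) := by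
  -- The relation is symmetric, and it holds locally by means of a segment in a ball. It is
  -- transitive since the roots for `a, b` and `b, c` can be multiplied and divided by `b - x`,
  -- which has no zero off `K`.
  refine hS.induction₂ (fun p q => ∃ K ⊆ U, IsClosed K ∧ IsPreconnected K ∧ p ∈ K ∧ q ∈ K ∧
      ∃ h : ℂ → ℂ, ContinuousOn h Kᶜ ∧ ∀ x ∉ K, h x ^ 2 = (p - x) * (q - x)) ?_ ?_ ?_ hp hq
  · intro x hx
    obtain ⟨ε, hε, hb⟩ := Metric.isOpen_iff.1 hU x (hSU hx)
    filter_upwards [mem_nhdsWithin_of_mem_nhds (Metric.ball_mem_nhds x hε)] with y hy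
    refine ⟨segment ℝ x y, ((convex_ball x ε).segment_subset (Metric.mem_ball_self hε) hy).trans hb,
      ?_, (convex_segment x y).isPreconnected, left_mem_segment ℝ x y, right_mem_segment ℝ x y,
      segSqrt x y, continuousOn_segSqrt x y, fun w hw => segSqrt_sq ?_⟩
    · rw [segment_eq_image_lineMap]
      exact (isCompact_Icc.image AffineMap.lineMap_continuous).isClosed
    · rintro rfl
      exact hw (left_mem_segment ℝ _ _)
  · rintro a b c - - - ⟨K, hKU, hK, hKc, ha, hb, h, hh, hsq⟩ ⟨K', hKU', hK', hKc', hb', hc, h', hh', hsq'⟩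
    refine ⟨K ∪ K', Set.union_subset hKU hKU', hK.union hK', hKc.union b hb hb' hKc', .inl ha,
      .inr hc, fun x => h x * h' x / (b - x), ?_, ?_⟩
    · refine ContinuousOn.div ((hh.mono ?_).mul (hh'.mono ?_)) (by fun_prop) ?_
      · exact Set.compl_subset_compl.2 Set.subset_union_left
      · exact Set.compl_subset_compl.2 Set.subset_union_right
      · intro x hx h0
        exact hx (.inl (by rwa [← sub_eq_zero.1 h0]))
    · intro x hx
      have hbx : b - x ≠ 0 := fun h0 => hx (.inl (by rwa [← sub_eq_zero.1 h0]))
      rw [div_pow, mul_pow, hsq x fun h => hx (.inl h), hsq' x fun h => hx (.inr h)]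
      field_simp
  · rintro a b - - ⟨K, hKU, hK, hKc, ha, hb, h, hh, hsq⟩
    exact ⟨K, hKU, hK, hKc, hb, ha, h, hh, fun x hx => by rw [hsq x hx, mul_comm]⟩

/-! ### Winding parity of cycles and the sides of edges -/

open scoped Classical in
/-- A drawing of a graph in the complex plane, straight on a disc around each vertex, together with
square roots that detect on which side of an edge a point lies. -/
structure SidedDrawing {V : Type*} [Fintype V] (G : SimpleGraph V) where
  /-- the position of a vertex -/
  point : V → ℂ
  /-- the radius of the circles around the vertices -/
  radius : ℝ
  /-- the curve that represents an edge -/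
  curve : G.edgeSet → Set ℂ
  /-- the angle at which an edge leaves a vertex -/
  angle : V → G.edgeSet → ℝ
  /-- a square root of the product of the differences to the two ends of an edge -/
  sqrt : G.edgeSet → ℂ → ℂ
  isClosed_curve : ∀ e, IsClosed (curve e)
  continuousOn_sqrt : ∀ e, ContinuousOn (sqrt e) (curve e)ᶜ
  sqrt_sq : ∀ e, ∀ x ∉ curve e, sqrt e x ^ 2 = ∏ v, if v ∈ e.1 then point v - x else 1
  point_mem : ∀ e, ∀ v ∈ e.1, point v ∈ curve e
  point_ne : ∀ u v (θ : ℝ), point u ≠ point v + radius * Complex.exp (θ * Complex.I)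
  circle : ∀ e v (θ : ℝ), point v + radius * Complex.exp (θ * Complex.I) ∈ curve e →
    v ∈ e.1 ∧ (θ : Real.Angle) = angle v e
  angle_injOn : ∀ v, Set.InjOn (fun e => (angle v e : Real.Angle)) {e | v ∈ e.1}
  jump : ∀ e, ∀ v ∈ e.1, Filter.Tendsto (fun η : ℝ =>
    sqrt e (point v + radius * Complex.exp ((angle v e + η : ℝ) * Complex.I)) /
      sqrt e (point v + radius * Complex.exp ((angle v e - η : ℝ) * Complex.I)))
    (nhdsWithin 0 (Set.Ioi 0)) (nhds (-1))
  connected : ∀ e, ∀ u ∈ e.1, ∀ v ∈ e.1, ∃ T : Set ℂ, IsPreconnected T ∧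
    point u + radius * Complex.exp (angle u e * Complex.I) ∈ T ∧
    point v + radius * Complex.exp (angle v e * Complex.I) ∈ T ∧
    ∀ e' ≠ e, Disjoint T (curve e')

/-- The sign character of `ZMod 2` with complex values. -/
noncomputable def zmodSign (a : ZMod 2) : ℂ := if a = 0 then 1 else -1

theorem zmodSign_add (a b : ZMod 2) : zmodSign (a + b) = zmodSign a * zmodSign b := by
  have h : ∀ c : ZMod 2, c = 0 ∨ c = 1 := by decide
  rcases h a with rfl | rfl <;> rcases h b with rfl | rfl <;>
    simp [zmodSign, CharTwo.add_self_eq_zero]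

theorem zmodSign_sum {ι : Type*} (s : Finset ι) (f : ι → ZMod 2) :
    zmodSign (∑ i ∈ s, f i) = ∏ i ∈ s, zmodSign (f i) := by
  classical
  induction s using Finset.induction_on with
  | empty => simp [zmodSign]
  | insert i s hi ih => rw [Finset.sum_insert hi, Finset.prod_insert hi, zmodSign_add, ih]

theorem zmodSign_mem (a : ZMod 2) : zmodSign a ∈ ({1, -1} : Set ℂ) := by
  unfold zmodSign
  split_ifs <;> simp

theorem zmodSign_injective : Function.Injective zmodSign := by
  intro a b h
  have h2 : ∀ c : ZMod 2, c = 0 ∨ c = 1 := by decide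
  rcases h2 a with rfl | rfl <;> rcases h2 b with rfl | rfl <;>
    first | rfl | norm_num [zmodSign] at h

namespace SidedDrawing

open Filter Topology
open scoped Classical

variable {V : Type*} [Fintype V] {G : SimpleGraph V} (S : SidedDrawing G)

/-- The point at angle `θ` of the circle around a vertex. -/
noncomputable def circlePoint (v : V) (θ : ℝ) : ℂ :=
  S.point v + S.radius * Complex.exp (θ * Complex.I)

theorem continuous_circlePoint (v : V) : Continuous (S.circlePoint v) := by
  unfold circlePoint
  fun_prop

theorem circlePoint_congr (v : V) {θ θ' : ℝ} (h : (θ : Real.Angle) = θ') :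
    S.circlePoint v θ = S.circlePoint v θ' := by
  obtain ⟨k, hk⟩ := Real.Angle.angle_eq_iff_two_pi_dvd_sub.1 h
  unfold circlePoint
  congr 2
  rw [Complex.exp_eq_exp_iff_exists_int]
  refine ⟨k, ?_⟩
  rw [sub_eq_iff_eq_add.1 hk]
  push_cast
  ring

/-- The sign of the square root of an edge relative to fixed square roots at the vertices. -/
noncomputable def bit (e : G.edgeSet) (x : ℂ) : ZMod 2 :=
  if S.sqrt e x = ∏ v, (if v ∈ e.1 then (S.point v - x) ^ (2⁻¹ : ℂ) else 1) then 0 else 1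

/-- The parity with which an element of the edge space winds around a point. -/
noncomputable def parity (x : ℂ) : (G.edgeSet → ZMod 2) →ₗ[ZMod 2] ZMod 2 :=
  ∑ e, S.bit e x • LinearMap.proj e

/-- The number of edges of `C` at a vertex. -/
noncomputable def degree (C : G.edgeSet → ZMod 2) (v : V) : ℕ :=
  (Finset.univ.filter fun e : G.edgeSet => C e ≠ 0 ∧ v ∈ e.1).card

/-- The product of the square roots of the edges of `C`. -/
noncomputable def sqrtProd (C : G.edgeSet → ZMod 2) (x : ℂ) : ℂ :=
  ∏ e with C e ≠ 0, S.sqrt e x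

/-- The square root of the square of `sqrtProd` that is a polynomial. -/
noncomputable def pointProd (C : G.edgeSet → ZMod 2) (x : ℂ) : ℂ :=
  ∏ v, (S.point v - x) ^ (degree C v / 2)

theorem even_degree {C : G.edgeSet → ZMod 2} (hC : C ∈ LinearMap.ker G.boundary) (v : V) :
    Even (degree C v) := by
  have h := SimpleGraph.mem_ker_boundary.1 hC v
  rw [← ZMod.natCast_eq_zero_iff_even, degree, Finset.card_eq_sum_ones, Nat.cast_sum,
    Finset.sum_filter]
  refine Eq.trans ?_ h
  have h2 : ∀ c : ZMod 2, c ≠ 0 → c = 1 := by decide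
  refine Finset.sum_congr rfl fun e _ => ?_
  by_cases h1 : C e = 0
  · simp [h1]
  · simp [h2 _ h1]

theorem parity_apply (C : G.edgeSet → ZMod 2) (x : ℂ) :
    S.parity x C = ∑ e with C e ≠ 0, S.bit e x := by
  have h2 : ∀ c : ZMod 2, c ≠ 0 → c = 1 := by decide
  rw [parity, LinearMap.sum_apply, Finset.sum_filter]
  refine Finset.sum_congr rfl fun e _ => ?_
  by_cases h : C e = 0
  · simp [h]
  · simp [h2 _ h]

theorem sqrt_eq (e : G.edgeSet) {x : ℂ} (hx : x ∉ S.curve e) :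
    S.sqrt e x = zmodSign (S.bit e x) *
      ∏ v, (if v ∈ e.1 then (S.point v - x) ^ (2⁻¹ : ℂ) else 1) := by
  unfold bit
  split_ifs with h
  · rw [h]; simp [zmodSign]
  · have h1 := S.sqrt_sq e x hx
    have h2 : (∏ v, if v ∈ e.1 then S.point v - x else 1) =
        (∏ v, (if v ∈ e.1 then (S.point v - x) ^ (2⁻¹ : ℂ) else 1)) ^ 2 := by
      rw [← Finset.prod_pow]
      refine Finset.prod_congr rfl fun v _ => ?_
      split_ifs
      · rw [cpow_half_sq]
      · simp
    rw [h2] at h1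
    rw [(sq_eq_sq_iff_eq_or_eq_neg.1 h1).resolve_left h]
    simp [zmodSign]

/-- `bit` compares with principal roots, which makes `parity` linear in `C` but not continuous edge
by edge. At each vertex a cycle uses the principal root an even number of times, so these roots
multiply to the polynomial `pointProd` and their discontinuities disappear. -/
theorem sqrtProd_eq {C : G.edgeSet → ZMod 2} (hC : C ∈ LinearMap.ker G.boundary) {x : ℂ}
    (hx : ∀ e, C e ≠ 0 → x ∉ S.curve e) :
    S.sqrtProd C x = zmodSign (S.parity x C) * S.pointProd C x := by
  have h1 : S.sqrtProd C x = ∏ e with C e ≠ 0, (zmodSign (S.bit e x) *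
      ∏ v, (if v ∈ e.1 then (S.point v - x) ^ (2⁻¹ : ℂ) else 1)) :=
    Finset.prod_congr rfl fun e he => S.sqrt_eq e (hx e (Finset.mem_filter.1 he).2)
  rw [h1, Finset.prod_mul_distrib, parity_apply, zmodSign_sum, Finset.prod_comm]
  congr 1
  refine Finset.prod_congr rfl fun v _ => ?_
  rw [← Finset.prod_filter, Finset.prod_const, Finset.filter_filter]
  obtain ⟨k, hk⟩ := even_degree hC v
  unfold degree at hk ⊢
  rw [hk, ← two_mul, pow_mul, cpow_half_sq, Nat.mul_div_cancel_left _ two_pos]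

theorem pointProd_ne_zero {C : G.edgeSet → ZMod 2} {x : ℂ} (hx : ∀ v, degree C v ≠ 0 → S.point v ≠ x) :
    S.pointProd C x ≠ 0 := by
  refine Finset.prod_ne_zero_iff.2 fun v _ => ?_
  by_cases h : degree C v = 0
  · simp [h]
  · exact pow_ne_zero _ (sub_ne_zero.2 (hx v h))

theorem continuous_pointProd (C : G.edgeSet → ZMod 2) : Continuous (S.pointProd C) := by
  unfold pointProd
  fun_prop

theorem pointProd_ne_zero_of_notMem {C : G.edgeSet → ZMod 2} {x : ℂ}
    (hx : ∀ e, C e ≠ 0 → x ∉ S.curve e) : S.pointProd C x ≠ 0 := by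
  refine S.pointProd_ne_zero fun v hv h => ?_
  obtain ⟨e, he⟩ := Finset.card_ne_zero.1 hv
  obtain ⟨-, he, hve⟩ := Finset.mem_filter.1 he
  exact hx e he (h ▸ S.point_mem e v hve)

theorem zmodSign_parity {C : G.edgeSet → ZMod 2} (hC : C ∈ LinearMap.ker G.boundary) {x : ℂ}
    (hx : ∀ e, C e ≠ 0 → x ∉ S.curve e) :
    zmodSign (S.parity x C) = S.sqrtProd C x / S.pointProd C x := by
  rw [S.sqrtProd_eq hC hx, mul_div_cancel_right₀ _ (S.pointProd_ne_zero_of_notMem hx)]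

/-- The winding parity of a cycle is constant on connected sets that avoid the cycle. -/
theorem parity_eq_of_isPreconnected {C : G.edgeSet → ZMod 2} (hC : C ∈ LinearMap.ker G.boundary)
    {T : Set ℂ} (hT : IsPreconnected T) (hd : ∀ e, C e ≠ 0 → Disjoint T (S.curve e)) {x y : ℂ}
    (hx : x ∈ T) (hy : y ∈ T) : S.parity x C = S.parity y C := by
  have hnot : ∀ z ∈ T, ∀ e, C e ≠ 0 → z ∉ S.curve e :=
    fun z hz e he => Set.disjoint_left.1 (hd e he) hz
  apply zmodSign_injective
  refine hT.constant_of_mapsTo (f := fun z => zmodSign (S.parity z C)) (T := {1, -1})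
    (Set.toFinite _).isDiscrete ?_ (fun z _ => zmodSign_mem _) hx hy
  refine ContinuousOn.congr (f := fun z => S.sqrtProd C z / S.pointProd C z) ?_
    fun z hz => S.zmodSign_parity hC (hnot z hz)
  refine ContinuousOn.div ?_ (S.continuous_pointProd C).continuousOn
    fun z hz => S.pointProd_ne_zero_of_notMem (hnot z hz)
  refine continuousOn_finsetProd _ fun e he => (S.continuousOn_sqrt e).mono fun z hz => ?_
  exact hnot z hz e (Finset.mem_filter.1 he).2

/-- The winding parity of a cycle changes across each of its edges. -/
theorem eventually_parity_add_parity {C : G.edgeSet → ZMod 2}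
    (hC : C ∈ LinearMap.ker G.boundary) {v : V} {e : G.edgeSet} (hv : v ∈ e.1) :
    ∀ᶠ η in 𝓝[>] (0 : ℝ), S.parity (S.circlePoint v (S.angle v e + η)) C +
      S.parity (S.circlePoint v (S.angle v e - η)) C = C e := by
  set a := S.angle v e with ha
  have hp0 : Tendsto (fun η : ℝ => S.circlePoint v (a + η)) (𝓝[>] 0) (𝓝 (S.circlePoint v a)) := by
    have h := ((S.continuous_circlePoint v).comp (continuous_const.add continuous_id)).tendsto
      (x := (0 : ℝ)) (f := fun η : ℝ => S.circlePoint v (a + η))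
    rw [add_zero] at h
    exact h.mono_left nhdsWithin_le_nhds
  have hm0 : Tendsto (fun η : ℝ => S.circlePoint v (a - η)) (𝓝[>] 0) (𝓝 (S.circlePoint v a)) := by
    have h := ((S.continuous_circlePoint v).comp (continuous_const.sub continuous_id)).tendsto
      (x := (0 : ℝ)) (f := fun η : ℝ => S.circlePoint v (a - η))
    rw [sub_zero] at h
    exact h.mono_left nhdsWithin_le_nhds
  have hoff : ∀ e' ≠ e, S.circlePoint v a ∉ S.curve e' := by
    intro e' he' h
    obtain ⟨h1, h2⟩ := S.circle e' v a h
    exact he' (S.angle_injOn v h1 hv h2.symm)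
  have hev : ∀ (s : ℝ → ℝ) (_ : ∀ η ∈ Set.Ioo 0 Real.pi, (s η : Real.Angle) ≠ a)
      (_ : Tendsto (fun η : ℝ => S.circlePoint v (s η)) (𝓝[>] 0) (𝓝 (S.circlePoint v a))),
      ∀ᶠ η in 𝓝[>] (0 : ℝ), ∀ e', S.circlePoint v (s η) ∉ S.curve e' := by
    intro s hs hlim
    refine eventually_all.2 fun e' => ?_
    by_cases he' : e' = e
    · subst he'
      filter_upwards [Ioo_mem_nhdsGT Real.pi_pos] with η hη h
      exact hs η hη (S.circle _ v _ h).2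
    · exact hlim.eventually ((S.isClosed_curve e').isOpen_compl.mem_nhds (hoff e' he'))
  have hangle : ∀ η ∈ Set.Ioo 0 Real.pi, (η : Real.Angle) ≠ 0 := by
    intro η hη h
    have h1 := congrArg Real.Angle.sin h
    rw [Real.Angle.sin_coe, Real.Angle.sin_zero] at h1
    exact (Real.sin_pos_of_pos_of_lt_pi hη.1 hη.2).ne' h1
  have hp := hev (fun η => a + η) (fun η hη h => hangle η hη (by
    simpa [Real.Angle.coe_add] using h)) hp0
  have hm := hev (fun η => a - η) (fun η hη h => hangle η hη (by
    simpa [Real.Angle.coe_sub] using h)) hm0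
  -- Only the root of `e` itself jumps; the other roots are continuous and nonzero at the crossing
  -- point.
  have hsq : Tendsto (fun η : ℝ => S.sqrtProd C (S.circlePoint v (a + η)) /
      S.sqrtProd C (S.circlePoint v (a - η))) (𝓝[>] 0) (𝓝 (zmodSign (C e))) := by
    have h1 : zmodSign (C e) = ∏ e' with C e' ≠ 0, if e' = e then (-1 : ℂ) else 1 := by
      rw [Finset.prod_ite_eq']
      simp [zmodSign, ite_not]
    rw [h1]
    simp only [sqrtProd, ← Finset.prod_div_distrib]
    refine tendsto_finsetProd _ fun e' _ => ?_
    by_cases he' : e' = e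
    · subst he'
      rw [if_pos rfl]
      exact S.jump _ v hv
    · rw [if_neg he']
      have hc : ContinuousAt (S.sqrt e') (S.circlePoint v a) :=
        (S.continuousOn_sqrt e').continuousAt
          ((S.isClosed_curve e').isOpen_compl.mem_nhds (hoff e' he'))
      have h0 : S.sqrt e' (S.circlePoint v a) ≠ 0 := by
        intro h0
        have h2 := S.sqrt_sq e' _ (hoff e' he')
        rw [h0, zero_pow two_ne_zero, eq_comm, Finset.prod_eq_zero_iff] at h2
        obtain ⟨u, -, hu⟩ := h2
        split_ifs at hu with hu'
        · exact S.point_ne u v a (sub_eq_zero.1 hu)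
        · exact one_ne_zero hu
      have h3 := (hc.tendsto.comp hp0).div (hc.tendsto.comp hm0) h0
      rwa [div_self h0] at h3
  have hpt : Tendsto (fun η : ℝ => S.pointProd C (S.circlePoint v (a + η)) /
      S.pointProd C (S.circlePoint v (a - η))) (𝓝[>] 0) (𝓝 1) := by
    have hc := (S.continuous_pointProd C).tendsto (S.circlePoint v a)
    have h0 : S.pointProd C (S.circlePoint v a) ≠ 0 :=
      S.pointProd_ne_zero fun u _ => S.point_ne u v a
    have h3 := (hc.comp hp0).div (hc.comp hm0) h0
    rwa [div_self h0] at h3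
  have hlim := hsq.div hpt one_ne_zero
  rw [div_one] at hlim
  -- The product of the two signs is `1` or `-1`, so being close to the limit `zmodSign (C e)`
  -- forces equality.
  have hne : ∀ᶠ z in 𝓝 (zmodSign (C e)), z ≠ -zmodSign (C e) := by
    refine isOpen_ne.mem_nhds ?_
    rcases zmodSign_mem (C e) with h | h <;> rw [h] <;> norm_num
  filter_upwards [hlim.eventually hne, hp, hm] with η h1 h2 h3
  apply zmodSign_injective
  rw [zmodSign_add]
  have hdiv : ∀ c : ZMod 2, (zmodSign c)⁻¹ = zmodSign c := by
    intro c
    rcases zmodSign_mem c with h | h <;> rw [h] <;> norm_num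
  have h4 : zmodSign (S.parity (S.circlePoint v (a + η)) C) *
      zmodSign (S.parity (S.circlePoint v (a - η)) C) ≠ -zmodSign (C e) := by
    rw [← hdiv (S.parity (S.circlePoint v (a - η)) C), ← div_eq_mul_inv,
      S.zmodSign_parity hC fun e' _ => h2 e', S.zmodSign_parity hC fun e' _ => h3 e']
    rwa [div_div_div_comm]
  rw [← zmodSign_add] at h4 ⊢
  rcases zmodSign_mem (C e) with h5 | h5 <;>
    rcases zmodSign_mem (S.parity (S.circlePoint v (a + η)) C +
      S.parity (S.circlePoint v (a - η)) C) with h6 | h6 <;>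
    rw [h5, h6] at h4 ⊢
  · exact absurd rfl h4
  · exact absurd (neg_neg _).symm h4

/-- The left side of `e` at `v` is the winding parity around a point of the sector from `e` to its
successor; the right side uses the sector that ends at `e`. -/
theorem mul_card_edgeSet_le (S : SidedDrawing G) [Nonempty V] {g : ℕ} (hg : (g : ℕ∞) ≤ G.egirth) :
    g * (Fintype.card G.edgeSet + 1) ≤ 2 * Fintype.card G.edgeSet + g * Fintype.card V := by
  have hrot := fun v : V => Real.Angle.exists_cyclic_successor
    (fun e : {e : G.edgeSet // v ∈ e.1} => S.angle v e.1)
    (fun e f h => Subtype.ext (S.angle_injOn v e.2 f.2 h))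
  choose σ δ hδ hσ hempty using hrot
  let corner : ∀ v, {e : G.edgeSet // v ∈ e.1} → ℂ :=
    fun v e => S.circlePoint v (S.angle v e.1 + δ v e / 2)
  let ℓ : ℂ → Module.Dual (ZMod 2) (LinearMap.ker G.boundary) :=
    fun x => (S.parity x).comp (LinearMap.ker G.boundary).subtype
  -- Parity is constant on the open sector. For a cycle that avoids `e` the sector may include the
  -- ray of `e` itself (`t = 0`), from where one can follow `e` to its other end.
  have harc : ∀ (v : V) (e : {e : G.edgeSet // v ∈ e.1}) (C : LinearMap.ker G.boundary) (t : ℝ),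
      (0 < t ∨ t = 0 ∧ C.1 e.1 = 0) → t < δ v e →
      ℓ (corner v e) C = S.parity (S.circlePoint v (S.angle v e.1 + t)) C.1 := by
    intro v e C t ht ht'
    refine S.parity_eq_of_isPreconnected C.2
      (T := S.circlePoint v '' ((fun s => S.angle v e.1 + s) ''
        {s | (0 < s ∨ s = 0 ∧ C.1 e.1 = 0) ∧ s < δ v e})) ?_ ?_ ?_ ?_
    · refine IsPreconnected.image ?_ _ (S.continuous_circlePoint v).continuousOn
      refine IsPreconnected.image ?_ _ (by fun_prop)
      by_cases h : C.1 e.1 = 0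
      · convert! isPreconnected_Ico (a := 0) (b := δ v e) using 1
        ext s
        simp [h, le_iff_lt_or_eq, eq_comm]
      · convert! isPreconnected_Ioo (a := 0) (b := δ v e) using 1
        ext s
        simp [h]
    · intro e' he'
      rw [Set.disjoint_left]
      rintro _ ⟨_, ⟨s, ⟨hs, hs'⟩, rfl⟩, rfl⟩ hmem
      obtain ⟨h1, h2⟩ := S.circle e' v _ hmem
      rcases hs with hs | ⟨rfl, h0⟩
      · exact hempty v e ⟨e', h1⟩ s hs hs' h2
      · simp only [add_zero] at h2
        have := S.angle_injOn v e.2 h1 h2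
        exact he' (this ▸ h0)
    · have := hδ v e
      exact ⟨_, ⟨δ v e / 2, ⟨.inl (by linarith), by linarith⟩, rfl⟩, rfl⟩
    · exact ⟨_, ⟨t, ⟨ht, ht'⟩, rfl⟩, rfl⟩
  refine SimpleGraph.mul_card_edgeSet_le_of_sides hg
    (fun v e => if h : v ∈ e.1 then ℓ (corner v ⟨e, h⟩) else 0)
    (fun v e => if h : v ∈ e.1 then ℓ (corner v ((σ v).symm ⟨e, h⟩)) else 0) ?_ ?_ ?_
  · intro v e hv C
    rw [dif_pos hv, dif_pos hv]
    set f := (σ v).symm ⟨e, hv⟩ with hf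
    have hσf : σ v f = ⟨e, hv⟩ := by simp [hf]
    have h1 : ∀ᶠ η in 𝓝[>] (0 : ℝ), η ∈ Set.Ioo 0 (δ v ⟨e, hv⟩) := Ioo_mem_nhdsGT (hδ _ _)
    have h2 : ∀ᶠ η in 𝓝[>] (0 : ℝ), η ∈ Set.Ioo 0 (δ v f) := Ioo_mem_nhdsGT (hδ _ _)
    obtain ⟨η, h3, h4, h5⟩ :=
      ((S.eventually_parity_add_parity C.2 hv).and (h1.and h2)).exists
    rw [← h3, harc v ⟨e, hv⟩ C η (.inl h4.1) h4.2,
      harc v f C (δ v f - η) (.inl (by linarith [h5.2])) (by linarith [h5.1])]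
    congr 3
    refine S.circlePoint_congr v ?_
    have h6 := hσ v f
    rw [hσf] at h6
    rw [add_sub, Real.Angle.coe_sub, ← h6, Real.Angle.coe_sub]
  · intro u v e hu hv C hC
    rw [dif_pos hu, dif_pos hv, harc u ⟨e, hu⟩ C 0 (.inr ⟨rfl, hC⟩) (hδ _ _),
      harc v ⟨e, hv⟩ C 0 (.inr ⟨rfl, hC⟩) (hδ _ _), add_zero, add_zero]
    obtain ⟨T, hT, huT, hvT, hd⟩ := S.connected e u hu v hv
    exact S.parity_eq_of_isPreconnected C.2 hT
      (fun e' he' => hd e' fun h => he' (h ▸ hC)) huT hvT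
  · intro v
    refine ⟨σ v, fun e => ?_⟩
    rw [dif_pos (σ v e).2, dif_pos e.2]
    simp

end SidedDrawing

/-! ### From planar drawings to drawings that are straight near the vertices -/

/-- A drawing of a graph in the complex plane in which every edge consists of a connected middle
part outside the discs of a given radius around the vertices and two radii of these discs. -/
structure StarDrawing {V : Type*} (G : SimpleGraph V) where
  /-- the position of a vertex -/
  point : V → ℂ
  /-- the radius of the discs -/
  radius : ℝ
  /-- the part of an edge outside the discs -/
  mid : G.edgeSet → Set ℂ
  /-- the point where an edge enters the disc around one of its ends -/
  port : V → G.edgeSet → ℂ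
  radius_pos : 0 < radius
  disjoint_closedBall : ∀ u v, u ≠ v →
    Disjoint (Metric.closedBall (point u) radius) (Metric.closedBall (point v) radius)
  isCompact_mid : ∀ e, IsCompact (mid e)
  isPreconnected_mid : ∀ e, IsPreconnected (mid e)
  port_mem : ∀ e, ∀ v ∈ e.1, port v e ∈ mid e
  dist_port : ∀ e, ∀ v ∈ e.1, dist (port v e) (point v) = radius
  eq_port : ∀ e, ∀ v ∈ e.1, ∀ x ∈ mid e, x ∈ Metric.closedBall (point v) radius → x = port v e
  disjoint_mid_closedBall : ∀ (e : G.edgeSet) (v : V), v ∉ e.1 →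
    Disjoint (mid e) (Metric.closedBall (point v) radius)
  disjoint_mid : ∀ e f, e ≠ f → Disjoint (mid e) (mid f)

/-- A path between the centres of two disjoint discs has a part that joins the two discs and meets
them only in its ends. -/
theorem Path.exists_subarc {X : Type*} [PseudoMetricSpace X] {a b : X} (γ : Path a b) {ρ : ℝ}
    (hρ : 0 < ρ) (hd : Disjoint (Metric.closedBall a ρ) (Metric.closedBall b ρ)) :
    ∃ M ⊆ Set.range γ, IsCompact M ∧ IsPreconnected M ∧ ∃ p ∈ M, ∃ q ∈ M, dist p a = ρ ∧
      dist q b = ρ ∧ (∀ x ∈ M, x ∈ Metric.closedBall a ρ → x = p) ∧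
      ∀ x ∈ M, x ∈ Metric.closedBall b ρ → x = q := by
  have hγ : Continuous γ.extend := γ.continuous_extend
  have hfa : Continuous fun t => dist (γ.extend t) a := hγ.dist continuous_const
  have hfb : Continuous fun t => dist (γ.extend t) b := hγ.dist continuous_const
  have ha : a ∈ Metric.closedBall a ρ := Metric.mem_closedBall_self hρ.le
  have hb : b ∈ Metric.closedBall b ρ := Metric.mem_closedBall_self hρ.le
  -- `s` is the last time in the disc around `a`, and `t` below is the first time from `s` on in the
  -- disc around `b`; by the intermediate value theorem both points lie at distance exactly `ρ`.
  obtain ⟨s, ⟨hs, hsa⟩, hsmax⟩ := IsCompact.exists_isGreatest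
    (s := Set.Icc (0 : ℝ) 1 ∩ {t | dist (γ.extend t) a ≤ ρ})
    (isCompact_Icc.inter_right (isClosed_le hfa continuous_const))
    ⟨0, by simp, by simpa using hρ.le⟩
  have hs1 : ∀ t ∈ Set.Icc s 1, dist (γ.extend t) a ≤ ρ → t = s := fun t ht h =>
    le_antisymm (hsmax ⟨⟨hs.1.trans ht.1, ht.2⟩, h⟩) ht.1
  obtain ⟨t, ⟨ht, htb⟩, htmin⟩ := IsCompact.exists_isLeast
    (s := Set.Icc s 1 ∩ {t | dist (γ.extend t) b ≤ ρ})
    (isCompact_Icc.inter_right (isClosed_le hfb continuous_const))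
    ⟨1, by simpa using hs.2, by simpa using hρ.le⟩
  have ht1 : ∀ x ∈ Set.Icc s t, dist (γ.extend x) b ≤ ρ → x = t := fun x hx h =>
    le_antisymm hx.2 (htmin ⟨⟨hx.1, hx.2.trans ht.2⟩, h⟩)
  have hsρ : dist (γ.extend s) a = ρ := by
    have h1 : ρ ≤ dist (γ.extend 1) a := by
      by_contra h
      refine Set.disjoint_left.1 hd ?_ hb
      simpa [Metric.mem_closedBall] using (not_le.1 h).le
    obtain ⟨x, hx, hxρ⟩ := intermediate_value_Icc hs.2 hfa.continuousOn ⟨hsa, h1⟩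
    rwa [hs1 x hx hxρ.le] at hxρ
  have htρ : dist (γ.extend t) b = ρ := by
    have h1 : ρ ≤ dist (γ.extend s) b := by
      by_contra h
      exact Set.disjoint_left.1 hd hsa (not_le.1 h).le
    obtain ⟨x, hx, hxρ⟩ := intermediate_value_Icc' ht.1 hfb.continuousOn ⟨htb, h1⟩
    rwa [ht1 x hx hxρ.le] at hxρ
  refine ⟨γ.extend '' Set.Icc s t, ?_, isCompact_Icc.image hγ,
    isPreconnected_Icc.image _ hγ.continuousOn, γ.extend s, ⟨s, ⟨le_rfl, ht.1⟩, rfl⟩, γ.extend t,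
    ⟨t, ⟨ht.1, le_rfl⟩, rfl⟩, hsρ, htρ, ?_, ?_⟩
  · rintro _ ⟨x, -, rfl⟩
    rw [← γ.extend_range]
    exact ⟨x, rfl⟩
  · rintro _ ⟨x, hx, rfl⟩ h
    rw [hs1 x ⟨hx.1, hx.2.trans ht.2⟩ h]
  · rintro _ ⟨x, hx, rfl⟩ h
    rw [ht1 x hx h]

-- For small `ρ` the discs are disjoint and miss the arcs that do not end at their centres. A common
-- point of two middle parts would be a vertex, hence the centre of a disc, but middle parts stay at
-- distance at least `ρ` from the ends of their edges.
open Filter Topology in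
theorem IsPlanar.nonempty_starDrawing {V : Type*} [Finite V] {G : SimpleGraph V}
    (hG : IsPlanar G) : Nonempty (StarDrawing G) := by
  classical
  obtain ⟨D⟩ := hG
  let ι : Plane ≃ₗᵢ[ℝ] ℂ := Complex.orthonormalBasisOneI.repr.symm
  let z : V → ℂ := fun v => ι (D.point v)
  have hz : Function.Injective z := ι.injective.comp D.point_injective
  let A : G.edgeSet → Set ℂ := fun e => ι '' D.arc e.1
  have hA : ∀ u v (h : G.Adj u v), ∃ γ : Path (z u) (z v), Set.range γ = A ⟨s(u, v), h⟩ := by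
    intro u v h
    obtain ⟨γ, -, hγ⟩ := D.isArcBetween u v h
    refine ⟨γ.map ι.continuous, ?_⟩
    simp only [A, ← hγ, Path.map_coe, Set.range_comp]
  have hAz : ∀ (e : G.edgeSet) w, z w ∈ A e → w ∈ e.1 := by
    rintro e w ⟨x, hx, hxw⟩
    rw [ι.injective hxw] at hx
    exact D.mem_of_point_mem e.1 e.2 w hx
  have hAA : ∀ e f : G.edgeSet, e ≠ f → A e ∩ A f ⊆ Set.range z := by
    rintro e f hef _ ⟨⟨x, hx, rfl⟩, ⟨y, hy, hxy⟩⟩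
    rw [ι.injective hxy] at hy
    obtain ⟨v, hv⟩ := D.inter_subset e.1 e.2 f.1 f.2 (fun h => hef (Subtype.ext h)) ⟨hx, hy⟩
    exact ⟨v, congrArg ι hv⟩
  have hAc : ∀ e, IsClosed (A e) := by
    rintro ⟨e, he⟩
    induction e using Sym2.ind with
    | _ u v =>
    obtain ⟨γ, hγ⟩ := hA u v he
    rw [← hγ]
    exact (isCompact_range γ.continuous).isClosed
  obtain ⟨ρ, hρ, hballs, hAball⟩ : ∃ ρ : ℝ, 0 < ρ ∧
      (∀ u v, u ≠ v → Disjoint (Metric.closedBall (z u) ρ) (Metric.closedBall (z v) ρ)) ∧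
      ∀ (e : G.edgeSet) (v : V), v ∉ e.1 → Disjoint (A e) (Metric.closedBall (z v) ρ) := by
    have h1 : ∀ᶠ ρ : ℝ in 𝓝[>] 0, ∀ u v, u ≠ v →
        Disjoint (Metric.closedBall (z u) ρ) (Metric.closedBall (z v) ρ) := by
      refine eventually_all.2 fun u => eventually_all.2 fun v => ?_
      by_cases huv : u = v
      · simp [huv]
      · have h0 : 0 < dist (z u) (z v) / 2 := half_pos (dist_pos.2 (hz.ne huv))
        filter_upwards [Ioo_mem_nhdsGT h0] with ρ hρ _
        exact Metric.closedBall_disjoint_closedBall (by linarith [hρ.2])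
    have h2 : ∀ᶠ ρ : ℝ in 𝓝[>] 0, ∀ (e : G.edgeSet) (v : V), v ∉ e.1 →
        Disjoint (A e) (Metric.closedBall (z v) ρ) := by
      refine eventually_all.2 fun e => eventually_all.2 fun v => ?_
      by_cases hv : v ∈ e.1
      · simp [hv]
      · obtain ⟨ε, hε, hb⟩ := Metric.isOpen_iff.1 (hAc e).isOpen_compl (z v)
          fun h => hv (hAz e v h)
        filter_upwards [Ioo_mem_nhdsGT hε] with ρ hρ _
        exact Set.disjoint_right.2 fun x hx =>
          hb (Metric.closedBall_subset_ball hρ.2 hx)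
    obtain ⟨ρ, ⟨h1, h2⟩, h3⟩ := ((h1.and h2).and (self_mem_nhdsWithin (s := Set.Ioi (0 : ℝ)))).exists
    exact ⟨ρ, h3, h1, h2⟩
  have hsub : ∀ e : G.edgeSet, ∃ M ⊆ A e, IsCompact M ∧ IsPreconnected M ∧ ∃ P : V → ℂ,
      ∀ v ∈ e.1, P v ∈ M ∧ dist (P v) (z v) = ρ ∧
        ∀ x ∈ M, x ∈ Metric.closedBall (z v) ρ → x = P v := by
    rintro ⟨e, he⟩
    induction e using Sym2.ind with
    | _ u v =>
    have huv : u ≠ v := G.ne_of_adj he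
    obtain ⟨γ, hγ⟩ := hA u v he
    obtain ⟨M, hM, hMc, hMp, p, hp, q, hq, hpu, hqv, hMu, hMv⟩ :=
      γ.exists_subarc hρ (hballs u v huv)
    refine ⟨M, hγ ▸ hM, hMc, hMp, fun w => if w = u then p else q, fun w hw => ?_⟩
    rcases Sym2.mem_iff.1 hw with rfl | rfl
    · simpa using ⟨hp, hpu, hMu⟩
    · simpa [huv.symm] using ⟨hq, hqv, hMv⟩
  choose M hMA hMc hMp P hP using hsub
  refine ⟨{
    point := z
    radius := ρ
    mid := M
    port := fun v e => P e v
    radius_pos := hρ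
    disjoint_closedBall := hballs
    isCompact_mid := hMc
    isPreconnected_mid := hMp
    port_mem := fun e v hv => (hP e v hv).1
    dist_port := fun e v hv => (hP e v hv).2.1
    eq_port := fun e v hv => (hP e v hv).2.2
    disjoint_mid_closedBall := fun e v hv => (hAball e v hv).mono_left (hMA e)
    disjoint_mid := fun e f hef => Set.disjoint_left.2 fun x hx hx' => ?_ }⟩
  obtain ⟨w, rfl⟩ := hAA e f hef ⟨hMA e hx, hMA f hx'⟩
  have hw : w ∈ e.1 := hAz e w (hMA e hx)
  have h1 := (hP e w hw).2.2 _ hx (Metric.mem_closedBall_self hρ.le)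
  have h2 := (hP e w hw).2.1
  rw [← h1, dist_self] at h2
  exact hρ.ne h2

/-! ### Square roots for the edges of a star drawing -/

theorem segment_subset_closedBall_of_dist_eq {E : Type*} [NormedAddCommGroup E] [NormedSpace ℝ E]
    {z p : E} {ρ : ℝ} (hp : dist p z = ρ) : segment ℝ z p ⊆ Metric.closedBall z ρ :=
  (convex_closedBall z ρ).segment_subset
    (Metric.mem_closedBall_self (hp ▸ dist_nonneg)) (Metric.mem_closedBall.2 hp.le)

/-- Two radii of a ball that have a point other than the centre in common are equal. -/
theorem eq_of_mem_segment_of_dist_eq {E : Type*} [NormedAddCommGroup E] [NormedSpace ℝ E]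
    {z p q x : E} {ρ : ℝ} (hp : dist p z = ρ) (hq : dist q z = ρ)
    (hxp : x ∈ segment ℝ z p) (hxq : x ∈ segment ℝ z q) (hx : x ≠ z) : p = q := by
  rw [segment_eq_image'] at hxp hxq
  obtain ⟨s, ⟨hs, -⟩, rfl⟩ := hxp
  obtain ⟨t, ⟨ht, -⟩, h⟩ := hxq
  have h1 : t • (q - z) = s • (p - z) := add_left_cancel h
  have h2 := congrArg norm h1
  rw [norm_smul, norm_smul, ← dist_eq_norm, ← dist_eq_norm, hp, hq, Real.norm_of_nonneg hs,
    Real.norm_of_nonneg ht] at h2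
  have hρ : ρ ≠ 0 := by
    intro h0
    rw [h0] at hp
    exact hx (by simp [dist_eq_zero.1 hp])
  have h3 := mul_right_cancel₀ hρ h2
  have hs0 : s ≠ 0 := by
    rintro rfl
    exact hx (by simp)
  rw [h3] at h1
  exact (sub_left_inj.1 (smul_right_injective E hs0 h1)).symm

theorem Real.Angle.coe_eq_coe_iff_exp_eq {θ α : ℝ} :
    (θ : Real.Angle) = α ↔ Complex.exp (θ * Complex.I) = Complex.exp (α * Complex.I) := by
  rw [Real.Angle.angle_eq_iff_two_pi_dvd_sub, Complex.exp_eq_exp_iff_exists_int]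
  refine exists_congr fun n => ?_
  have h1 : (α * Complex.I + n * (2 * Real.pi * Complex.I) : ℂ) =
      (α + n * (2 * Real.pi)) * Complex.I := by ring
  rw [h1, mul_left_inj' Complex.I_ne_zero, sub_eq_iff_eq_add']
  constructor <;> intro h
  · rw [h]
    push_cast
    ring
  · have h2 : θ = α + n * (2 * Real.pi) := by exact_mod_cast h
    rw [h2]
    ring

open scoped Classical in
theorem SimpleGraph.prod_ite_mem_edge {V M : Type*} [Fintype V] [CommMonoid M] {u v : V}
    (huv : u ≠ v) (f : V → M) :
    (∏ w, if w ∈ s(u, v) then f w else 1) = f u * f v := by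
  rw [← Finset.prod_filter, SimpleGraph.filter_mem_edge, Finset.prod_pair huv]

namespace StarDrawing

variable {V : Type*} {G : SimpleGraph V} (S : StarDrawing G)

/-- The straight part of an edge in the disc around one of its ends. -/
def spoke (v : V) (e : G.edgeSet) : Set ℂ := segment ℝ (S.point v) (S.port v e)

theorem isClosed_spoke (v : V) (e : G.edgeSet) : IsClosed (S.spoke v e) := by
  rw [spoke, segment_eq_image_lineMap]
  exact (isCompact_Icc.image AffineMap.lineMap_continuous).isClosed

theorem spoke_subset {v : V} {e : G.edgeSet} (hv : v ∈ e.1) :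
    S.spoke v e ⊆ Metric.closedBall (S.point v) S.radius :=
  segment_subset_closedBall_of_dist_eq (S.dist_port e v hv)

theorem port_ne {v : V} {e f : G.edgeSet} (hef : e ≠ f) (he : v ∈ e.1) (hf : v ∈ f.1) :
    S.port v e ≠ S.port v f := fun h =>
  Set.disjoint_left.1 (S.disjoint_mid e f hef) (S.port_mem e v he) (h ▸ S.port_mem f v hf)

theorem disjoint_mid_spoke {v : V} {e f : G.edgeSet} (hef : e ≠ f) (hf : v ∈ f.1) :
    Disjoint (S.mid e) (S.spoke v f) := by
  rw [Set.disjoint_left]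
  intro x hx hx'
  have hxb := S.spoke_subset hf hx'
  by_cases he : v ∈ e.1
  · have h1 := S.eq_port e v he x hx hxb
    refine S.port_ne hef he hf (eq_of_mem_segment_of_dist_eq (S.dist_port e v he)
      (S.dist_port f v hf) (right_mem_segment ℝ _ _) (h1 ▸ hx') ?_)
    intro h2
    have h3 := S.dist_port e v he
    rw [h2, dist_self] at h3
    exact S.radius_pos.ne h3
  · exact Set.disjoint_left.1 (S.disjoint_mid_closedBall e v he) hx hxb

theorem disjoint_mid_closedBall_half (e : G.edgeSet) (v : V) :
    Disjoint (S.mid e) (Metric.closedBall (S.point v) (S.radius / 2)) := by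
  have hr := S.radius_pos
  have hsub := Metric.closedBall_subset_closedBall (x := S.point v) (half_le_self hr.le)
  by_cases he : v ∈ e.1
  · rw [Set.disjoint_left]
    intro x hx hx'
    have h1 := S.eq_port e v he x hx (hsub hx')
    have h2 := S.dist_port e v he
    rw [← h1] at h2
    have h3 := Metric.mem_closedBall.1 hx'
    linarith
  · exact (S.disjoint_mid_closedBall e v he).mono_right hsub

/-- The direction in which an edge leaves a vertex. -/
noncomputable def angle (v : V) (e : G.edgeSet) : ℝ := (S.port v e - S.point v).arg

theorem port_eq {v : V} {e : G.edgeSet} (hv : v ∈ e.1) :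
    S.port v e = S.point v + S.radius * Complex.exp (S.angle v e * Complex.I) := by
  have h := Complex.norm_mul_exp_arg_mul_I (S.port v e - S.point v)
  rw [← dist_eq_norm, S.dist_port e v hv] at h
  rw [angle, h]
  ring

/-- The point half way on the straight part of an edge. -/
theorem half_eq {v : V} {e : G.edgeSet} (hv : v ∈ e.1) :
    S.point v + (S.radius / 2 : ℝ) * Complex.exp (S.angle v e * Complex.I) =
      S.point v + (2⁻¹ : ℝ) • (S.port v e - S.point v) := by
  rw [S.port_eq hv, Complex.real_smul]
  push_cast
  ring

theorem angle_eq_of_mem_spoke {v : V} {e : G.edgeSet} (hv : v ∈ e.1) {θ : ℝ}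
    (h : S.point v + (S.radius / 2 : ℝ) * Complex.exp (θ * Complex.I) ∈ S.spoke v e) :
    (θ : Real.Angle) = S.angle v e := by
  have hr := S.radius_pos
  have hr' : (S.radius : ℂ) ≠ 0 := by exact_mod_cast hr.ne'
  rw [Real.Angle.coe_eq_coe_iff_exp_eq]
  have h1 : S.point v + S.radius * Complex.exp (θ * Complex.I) = S.port v e := by
    refine eq_of_mem_segment_of_dist_eq (ρ := S.radius) ?_ (S.dist_port e v hv) ?_ h ?_
    · rw [dist_eq_norm, add_sub_cancel_left, norm_mul, Complex.norm_exp_ofReal_mul_I, mul_one,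
        Complex.norm_real, Real.norm_of_nonneg hr.le]
    · rw [segment_eq_image']
      refine ⟨2⁻¹, by norm_num, ?_⟩
      simp only [Complex.real_smul]
      push_cast
      ring
    · simp [hr.ne']
  rw [S.port_eq hv] at h1
  exact mul_left_cancel₀ hr' (add_left_cancel h1)

theorem point_ne_half (u v : V) (θ : ℝ) :
    S.point u ≠ S.point v + (S.radius / 2 : ℝ) * Complex.exp (θ * Complex.I) := by
  have hr := S.radius_pos
  have h1 : dist (S.point v + (S.radius / 2 : ℝ) * Complex.exp (θ * Complex.I)) (S.point v) =
      S.radius / 2 := by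
    rw [dist_eq_norm, add_sub_cancel_left, norm_mul, Complex.norm_exp_ofReal_mul_I, mul_one,
      Complex.norm_real, Real.norm_of_nonneg (by linarith)]
  intro h
  rw [← h] at h1
  by_cases huv : u = v
  · subst huv
    rw [dist_self] at h1
    linarith
  · refine Set.disjoint_left.1 (S.disjoint_closedBall u v huv)
      (Metric.mem_closedBall_self hr.le) (Metric.mem_closedBall.2 ?_)
    linarith

theorem half_mem_closedBall (v : V) (θ : ℝ) :
    S.point v + (S.radius / 2 : ℝ) * Complex.exp (θ * Complex.I) ∈
      Metric.closedBall (S.point v) (S.radius / 2) := by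
  rw [Metric.mem_closedBall, dist_eq_norm, add_sub_cancel_left, norm_mul,
    Complex.norm_exp_ofReal_mul_I, mul_one, Complex.norm_real,
    Real.norm_of_nonneg (by linarith [S.radius_pos])]

open scoped Classical in
/-- The middle parts of the edges can be replaced by sets off which there are square roots. -/
theorem exists_mid_sqrt [Fintype V] :
    ∃ (K : G.edgeSet → Set ℂ) (h : G.edgeSet → ℂ → ℂ), (∀ e, IsClosed (K e)) ∧
      (∀ e, IsPreconnected (K e)) ∧ (∀ e, ∀ v ∈ e.1, S.port v e ∈ K e) ∧
      (∀ e f, e ≠ f → Disjoint (K e) (K f)) ∧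
      (∀ e f, e ≠ f → ∀ v ∈ f.1, Disjoint (K e) (S.spoke v f)) ∧
      (∀ e v, Disjoint (K e) (Metric.closedBall (S.point v) (S.radius / 2))) ∧
      (∀ e, ContinuousOn (h e) (K e)ᶜ) ∧
      ∀ e, ∀ x ∉ K e, h e x ^ 2 = ∏ v, if v ∈ e.1 then S.port v e - x else 1 := by
  -- `B e` is what the new middle part of `e` has to avoid. The discs have half the radius because
  -- the middle parts touch the full discs at the ports.
  let B : G.edgeSet → Set ℂ := fun e => (⋃ f : {f // e ≠ f}, S.mid f.1) ∪
    (⋃ f : {f // e ≠ f}, ⋃ v : {v // v ∈ f.1.1}, S.spoke v.1 f.1) ∪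
    ⋃ v, Metric.closedBall (S.point v) (S.radius / 2)
  have hB : ∀ e, IsClosed (B e) := fun e =>
    ((isClosed_iUnion_of_finite fun f : {f // e ≠ f} => (S.isCompact_mid f.1).isClosed).union
      (isClosed_iUnion_of_finite fun f : {f // e ≠ f} =>
        isClosed_iUnion_of_finite fun v : {v // v ∈ f.1.1} => S.isClosed_spoke v.1 f.1)).union
      (isClosed_iUnion_of_finite fun v => Metric.isClosed_closedBall)
  have hBd : ∀ e, Disjoint (S.mid e) (B e) := by
    intro e
    simp only [B, Set.disjoint_union_right, Set.disjoint_iUnion_right]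
    exact ⟨⟨fun f => S.disjoint_mid e f.1 f.2, fun f v => S.disjoint_mid_spoke f.2 v.2⟩,
      fun v => S.disjoint_mid_closedBall_half e v⟩
  have hmidB : ∀ e f, e ≠ f → S.mid f ⊆ B e := fun e f hef x hx =>
    .inl (.inl (Set.mem_iUnion.2 ⟨⟨f, hef⟩, hx⟩))
  have hspB : ∀ e f, e ≠ f → ∀ v ∈ f.1, S.spoke v f ⊆ B e := fun e f hef v hv x hx =>
    .inl (.inr (Set.mem_iUnion.2 ⟨⟨f, hef⟩, Set.mem_iUnion.2 ⟨⟨v, hv⟩, hx⟩⟩))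
  have hballB : ∀ e v, Metric.closedBall (S.point v) (S.radius / 2) ⊆ B e := fun e v x hx =>
    .inr (Set.mem_iUnion.2 ⟨v, hx⟩)
  have hsep : ∀ e, ∃ U W : Set ℂ, IsOpen U ∧ IsOpen W ∧ S.mid e ⊆ U ∧ B e ⊆ W ∧ Disjoint U W :=
    fun e => SeparatedNhds.of_isCompact_isClosed (S.isCompact_mid e) (hB e) (hBd e)
  choose U W hU hW hMU hBW hUW using hsep
  -- Intersecting with the `W f` makes these neighbourhoods pairwise disjoint, so that the new
  -- middle parts are disjoint from each other.
  let U' : G.edgeSet → Set ℂ := fun e => U e ∩ ⋂ f : {f // f ≠ e}, W f.1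
  have hU' : ∀ e, IsOpen (U' e) := fun e => (hU e).inter (isOpen_iInter_of_finite fun f => hW f.1)
  have hMU' : ∀ e, S.mid e ⊆ U' e := fun e x hx =>
    ⟨hMU e hx, Set.mem_iInter.2 fun f => hBW f.1 (hmidB f.1 e f.2 hx)⟩
  have hex : ∀ e : G.edgeSet, ∃ K ⊆ U' e, IsClosed K ∧ IsPreconnected K ∧
      (∀ v ∈ e.1, S.port v e ∈ K) ∧ ∃ h : ℂ → ℂ, ContinuousOn h Kᶜ ∧
        ∀ x ∉ K, h x ^ 2 = ∏ v, if v ∈ e.1 then S.port v e - x else 1 := by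
    rintro ⟨e, he⟩
    induction e using Sym2.ind with
    | _ u v =>
    have huv : u ≠ v := G.ne_of_adj he
    obtain ⟨K, hK, hKc, hKp, hp, hq, h, hh, hsq⟩ := exists_continuous_sqrt (hU' ⟨s(u, v), he⟩)
      (S.isPreconnected_mid ⟨s(u, v), he⟩) (hMU' ⟨s(u, v), he⟩)
      (S.port_mem ⟨s(u, v), he⟩ u (Sym2.mem_mk_left u v))
      (S.port_mem ⟨s(u, v), he⟩ v (Sym2.mem_mk_right u v))
    refine ⟨K, hK, hKc, hKp, fun w hw => ?_, h, hh, fun x hx => ?_⟩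
    · rcases Sym2.mem_iff.1 hw with rfl | rfl
      exacts [hp, hq]
    · rw [hsq x hx]
      exact (SimpleGraph.prod_ite_mem_edge huv fun w => S.port w ⟨s(u, v), he⟩ - x).symm
  choose K hKU hKc hKp hport h hh hsq using hex
  have hKB : ∀ e, Disjoint (K e) (B e) := fun e =>
    (hUW e).mono ((hKU e).trans Set.inter_subset_left) (hBW e)
  refine ⟨K, h, hKc, hKp, hport, fun e f hef => ?_,
    fun e f hef v hv => (hKB e).mono_right (hspB e f hef v hv),
    fun e v => (hKB e).mono_right (hballB e v), hh, hsq⟩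
  refine (hUW e).mono ((hKU e).trans Set.inter_subset_left) ((hKU f).trans ?_)
  exact Set.inter_subset_right.trans (Set.iInter_subset_of_subset ⟨e, hef⟩ subset_rfl)

open scoped Classical in
open Filter Topology in
theorem nonempty_sidedDrawing (S : StarDrawing G) [Fintype V] : Nonempty (SidedDrawing G) := by
  obtain ⟨K, h, hKc, hKp, hport, hKK, hKs, hKb, hh, hsq⟩ := S.exists_mid_sqrt
  have hr := S.radius_pos
  let c : G.edgeSet → Set ℂ := fun e => K e ∪ ⋃ v : {v // v ∈ e.1}, S.spoke v.1 e
  -- `h e` squares to the product of the `port - x`; each further factor squares to `(point - x) /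
  -- (port - x)` and so moves the end from the port to the vertex.
  let F : G.edgeSet → ℂ → ℂ := fun e x => h e x *
    ∏ v, if v ∈ e.1 then segSqrt (S.point v) (S.port v e) x / (S.port v e - x) else 1
  have hmem : ∀ {e x}, x ∉ c e → x ∉ K e ∧ ∀ v ∈ e.1, x ∉ S.spoke v e := fun hx =>
    ⟨fun h => hx (.inl h), fun v hv h => hx (.inr (Set.mem_iUnion.2 ⟨⟨v, hv⟩, h⟩))⟩
  have hpne : ∀ {e x}, x ∉ K e → ∀ v ∈ e.1, S.port v e - x ≠ 0 := fun {e x} hx v hv h0 =>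
    hx (sub_eq_zero.1 h0 ▸ hport e v hv)
  have hfac : ∀ {e : G.edgeSet} {v : V}, v ∈ e.1 → ∀ {x}, x ∉ K e → x ∉ S.spoke v e →
      ContinuousAt (fun x => segSqrt (S.point v) (S.port v e) x / (S.port v e - x)) x := by
    intro e v hv x hx hx'
    refine ContinuousAt.div ?_ (by fun_prop) (hpne hx v hv)
    exact (continuousOn_segSqrt _ _).continuousAt ((S.isClosed_spoke v e).isOpen_compl.mem_nhds hx')
  have hsqrt_sq : ∀ {e : G.edgeSet} {v : V} {x : ℂ}, x ∉ S.spoke v e →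
      segSqrt (S.point v) (S.port v e) x ^ 2 = (S.point v - x) * (S.port v e - x) :=
    fun hx => segSqrt_sq fun h => hx (h ▸ left_mem_segment ℝ _ _)
  have hcirc : ∀ (e : G.edgeSet) v (θ : ℝ),
      S.point v + (S.radius / 2 : ℝ) * Complex.exp (θ * Complex.I) ∈ c e →
      ∃ hv : v ∈ e.1, S.point v + (S.radius / 2 : ℝ) * Complex.exp (θ * Complex.I) ∈
        S.spoke v e := by
    intro e v θ hθ
    have hb := S.half_mem_closedBall v θ
    rcases hθ with hθ | hθ
    · exact absurd hb (Set.disjoint_left.1 (hKb e v) hθ)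
    · obtain ⟨⟨u, hu⟩, hus⟩ := Set.mem_iUnion.1 hθ
      by_cases huv : u = v
      · subst huv
        exact ⟨hu, hus⟩
      · exact absurd (Metric.closedBall_subset_closedBall (half_le_self hr.le) hb)
          (Set.disjoint_left.1 (S.disjoint_closedBall u v huv) (S.spoke_subset hu hus))
  refine ⟨{
    point := S.point
    radius := S.radius / 2
    curve := c
    angle := S.angle
    sqrt := F
    isClosed_curve := fun e =>
      (hKc e).union (isClosed_iUnion_of_finite fun v => S.isClosed_spoke v.1 e)
    continuousOn_sqrt := fun e x hx => ?_
    sqrt_sq := fun e x hx => ?_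
    point_mem := fun e v hv =>
      .inr (Set.mem_iUnion.2 ⟨⟨v, hv⟩, left_mem_segment ℝ _ _⟩)
    point_ne := S.point_ne_half
    circle := fun e v θ hθ => ?_
    angle_injOn := fun v e he f hf hef => ?_
    jump := fun e v hv => ?_
    connected := fun e u hu v hv => ?_ }⟩
  · obtain ⟨h1, h2⟩ := hmem hx
    refine ContinuousAt.continuousWithinAt (ContinuousAt.mul
      ((hh e).continuousAt ((hKc e).isOpen_compl.mem_nhds h1)) (tendsto_finsetProd _ fun v _ => ?_))
    by_cases hv : v ∈ e.1
    · simp only [if_pos hv]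
      exact hfac hv h1 (h2 v hv)
    · simp only [if_neg hv]
      exact tendsto_const_nhds
  · obtain ⟨h1, h2⟩ := hmem hx
    simp only [F]
    rw [mul_pow, hsq e x h1, ← Finset.prod_pow, ← Finset.prod_mul_distrib]
    refine Finset.prod_congr rfl fun v _ => ?_
    by_cases hv : v ∈ e.1
    · have h3 := hpne h1 v hv
      simp only [if_pos hv]
      rw [div_pow, hsqrt_sq (h2 v hv)]
      field_simp
    · simp [if_neg hv]
  · obtain ⟨hv, h1⟩ := hcirc e v θ hθ
    exact ⟨hv, S.angle_eq_of_mem_spoke hv h1⟩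
  · by_contra hne
    refine S.port_ne hne he hf ?_
    rw [S.port_eq he, S.port_eq hf, Real.Angle.coe_eq_coe_iff_exp_eq.1 hef]
  · set w := fun η : ℝ =>
      S.point v + (S.radius / 2 : ℝ) * Complex.exp ((S.angle v e + η : ℝ) * Complex.I) with hw
    have hwc : Continuous w := by
      simp only [hw]
      fun_prop
    -- `Q` collects the factors that are continuous and nonzero at the crossing point, so the jump
    -- is that of `segSqrt` on the spoke at `v`.
    let Q : ℂ → ℂ := fun x => h e x * ((∏ u ∈ Finset.univ.erase v,
      if u ∈ e.1 then segSqrt (S.point u) (S.port u e) x / (S.port u e - x) else 1) /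
        (S.port v e - x))
    have hFQ : ∀ x, F e x = segSqrt (S.point v) (S.port v e) x * Q x := by
      intro x
      simp only [F, Q]
      rw [← Finset.mul_prod_erase _ _ (Finset.mem_univ v), if_pos hv]
      ring
    have hb := S.half_mem_closedBall v (S.angle v e + 0)
    have h1 : w 0 ∉ K e := fun h => Set.disjoint_left.1 (hKb e v) h hb
    have h2 : ∀ u ∈ e.1, u ≠ v → w 0 ∉ S.spoke u e := fun u hu huv hus =>
      Set.disjoint_left.1 (S.disjoint_closedBall u v huv) (S.spoke_subset hu hus)
        (Metric.closedBall_subset_closedBall (half_le_self hr.le) hb)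
    have hQc : ContinuousAt Q (w 0) := by
      refine ContinuousAt.mul ((hh e).continuousAt ((hKc e).isOpen_compl.mem_nhds h1))
        (ContinuousAt.div (tendsto_finsetProd _ fun u hu => ?_) (by fun_prop) (hpne h1 v hv))
      by_cases hue : u ∈ e.1
      · simp only [if_pos hue]
        exact hfac hue h1 (h2 u hue (Finset.ne_of_mem_erase hu))
      · simp only [if_neg hue]
        exact tendsto_const_nhds
    have hQ0 : Q (w 0) ≠ 0 := by
      refine mul_ne_zero ?_ (div_ne_zero (Finset.prod_ne_zero_iff.2 fun u hu => ?_) (hpne h1 v hv))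
      · intro h0
        have h3 := hsq e _ h1
        rw [h0, zero_pow two_ne_zero, eq_comm, Finset.prod_eq_zero_iff] at h3
        obtain ⟨u, -, hu⟩ := h3
        split_ifs at hu with hue
        · exact hpne h1 u hue hu
        · exact one_ne_zero hu
      · split_ifs with hue
        · refine div_ne_zero (fun h0 => ?_) (hpne h1 u hue)
          have h3 := hsqrt_sq (h2 u hue (Finset.ne_of_mem_erase hu))
          rw [h0, zero_pow two_ne_zero, eq_comm, mul_eq_zero] at h3
          rcases h3 with h3 | h3
          · exact S.point_ne_half u v _ (sub_eq_zero.1 h3)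
          · exact hpne h1 u hue h3
        · exact one_ne_zero
    have hlim : ∀ s : ℝ, Tendsto (fun η : ℝ => w (s * η)) (𝓝[>] 0) (𝓝 (w 0)) := by
      intro s
      have h3 := (hwc.comp (continuous_const_mul s)).tendsto (0 : ℝ)
      simp only [Function.comp_apply, mul_zero] at h3
      exact h3.mono_left nhdsWithin_le_nhds
    have hQlim := (hQc.tendsto.comp (hlim 1)).div (hQc.tendsto.comp (hlim (-1))) hQ0
    rw [div_self hQ0] at hQlim
    have hseg := tendsto_segSqrt_div_segSqrt (S.point v) (half_pos hr) (S.angle v e)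
    have hport2 : S.point v + (2 * (S.radius / 2) : ℝ) * Complex.exp (S.angle v e * Complex.I) =
        S.port v e := by
      rw [S.port_eq hv, mul_div_cancel₀ _ two_ne_zero]
    rw [hport2] at hseg
    have hprod := hseg.mul hQlim
    rw [mul_one] at hprod
    refine hprod.congr fun η => ?_
    simp only [hFQ, Pi.div_apply, Function.comp_apply, hw, one_mul, neg_one_mul, ← sub_eq_add_neg]
    rw [div_mul_div_comm]
  -- Outer halves of the spokes: they join the half-radius circle to the port and avoid the vertex,
  -- where other edges meet.
  · let T : V → Set ℂ := fun u => (fun t : ℝ => S.point u + t • (S.port u e - S.point u)) ''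
      Set.Icc 2⁻¹ 1
    have hTc : ∀ u, IsPreconnected (T u) := fun u =>
      isPreconnected_Icc.image _ (by fun_prop)
    have hTs : ∀ u, T u ⊆ S.spoke u e := by
      rintro u _ ⟨t, ht, rfl⟩
      rw [spoke, segment_eq_image']
      exact ⟨t, ⟨by linarith [ht.1, show (0 : ℝ) < 2⁻¹ by norm_num], ht.2⟩, rfl⟩
    have hTport : ∀ u, S.port u e ∈ T u := fun u => ⟨1, by norm_num, by simp⟩
    have hThalf : ∀ u ∈ e.1,
        S.point u + (S.radius / 2 : ℝ) * Complex.exp (S.angle u e * Complex.I) ∈ T u :=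
      fun u hu => ⟨2⁻¹, by norm_num, (S.half_eq hu).symm⟩
    have hTne : ∀ u ∈ e.1, ∀ x ∈ T u, x ≠ S.point u := by
      rintro u hu _ ⟨t, ht, rfl⟩ h0
      have h1 := add_eq_left.1 h0
      rcases smul_eq_zero.1 h1 with h1 | h1
      · rw [h1] at ht
        norm_num at ht
      · have h2 := S.dist_port e u hu
        rw [sub_eq_zero.1 h1, dist_self] at h2
        exact hr.ne h2
    have hTd : ∀ u ∈ e.1, ∀ f ≠ e, Disjoint (T u) (c f) := by
      intro u hu f hf
      rw [Set.disjoint_union_right, Set.disjoint_iUnion_right]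
      refine ⟨((hKs f e hf u hu).mono_right (hTs u)).symm, fun ⟨y, hy⟩ => ?_⟩
      by_cases huy : u = y
      · subst huy
        exact Set.disjoint_left.2 fun x hx hx' => S.port_ne hf hy hu
          (eq_of_mem_segment_of_dist_eq (S.dist_port f u hy) (S.dist_port e u hu) hx' (hTs u hx)
            (hTne u hu x hx))
      · exact (S.disjoint_closedBall u y huy).mono ((hTs u).trans (S.spoke_subset hu))
          (S.spoke_subset hy)
    refine ⟨T u ∪ K e ∪ T v, ?_, .inl (.inl (hThalf u hu)), .inr (hThalf v hv), fun f hf => ?_⟩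
    · exact ((hTc u).union _ (hTport u) (hport e u hu) (hKp e)).union _ (.inr (hport e v hv))
        (hTport v) (hTc v)
    · rw [Set.disjoint_union_left, Set.disjoint_union_left]
      refine ⟨⟨hTd u hu f hf, ?_⟩, hTd v hv f hf⟩
      rw [Set.disjoint_union_right, Set.disjoint_iUnion_right]
      exact ⟨hKK e f hf.symm, fun y => hKs e f hf.symm y.1 y.2⟩

end StarDrawing

/-! ### Passage to subgraphs and the conclusion -/

/-- A planar graph with `n` vertices, `m` edges and girth at least `g` has
`g * (m + 1) ≤ 2 * m + g * n`. -/
theorem IsPlanar.mul_ncard_edgeSet_le {V : Type*} [Finite V] [Nonempty V] {G : SimpleGraph V}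
    (hG : IsPlanar G) {g : ℕ} (hg : (g : ℕ∞) ≤ G.egirth) :
    g * (G.edgeSet.ncard + 1) ≤ 2 * G.edgeSet.ncard + g * Nat.card V := by
  classical
  have : Fintype V := Fintype.ofFinite V
  obtain ⟨S⟩ := hG.nonempty_starDrawing
  obtain ⟨S⟩ := S.nonempty_sidedDrawing
  have h := S.mul_card_edgeSet_le hg
  rwa [← Nat.card_eq_fintype_card, ← Nat.card_eq_fintype_card, Nat.card_coe_set_eq] at h

/-- A graph that embeds into a planar graph is planar. -/
theorem IsPlanar.of_injective {V W : Type*} {G : SimpleGraph V} {H : SimpleGraph W}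
    (hG : IsPlanar G) (f : H →g G) (hf : Function.Injective f) : IsPlanar H := by
  obtain ⟨D⟩ := hG
  have hmap : ∀ e ∈ H.edgeSet, Sym2.map f e ∈ G.edgeSet := fun e he => f.map_mem_edgeSet he
  refine ⟨{
    point := fun w => D.point (f w)
    arc := fun e => D.arc (Sym2.map f e)
    point_injective := D.point_injective.comp hf
    isArcBetween := fun u v h => D.isArcBetween (f u) (f v) (f.map_adj h)
    mem_of_point_mem := fun e he w hw => ?_
    inter_subset := fun e he e' he' hne x hx => ?_ }⟩
  · obtain ⟨u, hu, huw⟩ := Sym2.mem_map.1 (D.mem_of_point_mem _ (hmap e he) _ hw)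
    rwa [← hf huw]
  · have hne' : Sym2.map f e ≠ Sym2.map f e' := fun h => hne (Sym2.map.injective hf h)
    obtain ⟨v, rfl⟩ := D.inter_subset _ (hmap e he) _ (hmap e' he') hne' hx
    -- The common point is a vertex of `G` on an image edge, hence an end of that edge and so in the
    -- image of `f`.
    have hv := D.mem_of_point_mem _ (hmap e he) v hx.1
    obtain ⟨u, -, rfl⟩ := Sym2.mem_map.1 hv
    exact ⟨u, rfl⟩

theorem mainTheorem9 {V : Type*} [Finite V] (G : SimpleGraph V) (hG : IsPlanar G)
    (g : ℕ) (hg : 3 ≤ g) (hgirth : (g : ℕ∞) ≤ G.egirth) :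
    mad G < 2 * (g : ℝ) / ((g : ℝ) - 2) := by
  have hg' : (3 : ℝ) ≤ g := by exact_mod_cast hg
  rcases isEmpty_or_nonempty V with hV | hV
  · have h0 : subgraphAverageDegrees G = ∅ := by
      refine Set.eq_empty_of_forall_notMem ?_
      rintro x ⟨H, h, -⟩
      rw [Set.eq_empty_of_isEmpty H.verts, Set.ncard_empty] at h
      omega
    rw [mad, h0, Real.sSup_empty]
    exact div_pos (by linarith) (by linarith)
  obtain ⟨H, hH, hmad⟩ := (mad_isGreatest G).1
  have hne : Nonempty H.verts := by
    obtain ⟨v, hv⟩ := Set.nonempty_of_ncard_ne_zero (by omega : H.verts.ncard ≠ 0)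
    exact ⟨⟨v, hv⟩⟩
  have hHg : (g : ℕ∞) ≤ H.coe.egirth :=
    hgirth.trans (SimpleGraph.IsContained.egirth_le ⟨H.hom, H.hom_injective⟩)
  have h := (hG.of_injective H.hom H.hom_injective).mul_ncard_edgeSet_le hHg
  have hcard : H.coe.edgeSet.ncard = H.edgeSet.ncard := by
    rw [← H.image_coe_edgeSet_coe]
    exact (Set.ncard_image_of_injective _ (Sym2.map.injective Subtype.val_injective)).symm
  rw [hcard, Nat.card_coe_set_eq] at h
  have h' : (g : ℝ) * (H.edgeSet.ncard + 1) ≤ 2 * H.edgeSet.ncard + g * H.verts.ncard := by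
    exact_mod_cast h
  have hpos : (0 : ℝ) < H.verts.ncard := by exact_mod_cast hH
  rw [hmad, div_lt_div_iff₀ hpos (by linarith)]
  -- `h'` says `(g - 2) m ≤ g (n - 1)`; the strict inequality comes from the `+ 1`.
  nlinarith
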